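/- Let $\mathbb{T}^2=\mathbb{R}^2/\mathbb{Z}^2$ with universal covering map $\pi:\mathbb{R}^2\to\mathbb{T}^2$. A homeomorphism $\tilde\phi$ of $\mathbb{R}^2$ is a lift of a homeomorphism $\phi$ of $\mathbb{T}^2$ if $\pi\circ\tilde\phi=\phi\circ\pi$. For $X=\mathbb{T}^2$ or $\mathbb{R}^2$, let $\mathrm{Homeo}(X)$ be the group of homeomorphisms of $X$ and $\mathrm{Homeo}_0(X)$ the subgroup of those isotopic to the identity. For $\psi\in\mathrm{Homeo}(\mathbb{T}^2)$ let $L(\psi)=\sum_n(-1)^n\,\mathrm{tr}\big(\psi_*:H_n(\mathbb{T}^2;\mathbb{Q})\to H_n(\mathbb{T}^2;\mathbb{Q})\big)$ be its Lefschetz number. Let $G$ be a subgroup of $\mathrm{Homeo}(\mathbb{T}^2)$. Put $G_0=G\cap\mathrm{Homeo}_0(\mathbb{T}^2)$ and let $\mathcal{P}(G)$ be the set of Borel probability measures on $\mathbb{T}^2$ invariant under every element of $G$. For a lift $\tilde\phi$ of $\phi\in G_0$, the map $\tilde\phi-\mathrm{Id}$ is $\mathbb{Z}^2$-periodic, hence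 descends to $\mathbb{T}^2$; for $\mu\in\mathcal{P}(G)$ put $\rho_\mu(\tilde\phi)=\int_{\mathbb{T}^2}(\tilde\phi-\mathrm{Id})\,d\mu\in\mathbb{R}^2$. Define $$G^\mu_{\mathcal I}=\{\phi\in G_0 : \text{some lift }\tilde\phi\text{ of }\phi\text{ satisfies }\rho_\mu(\tilde\phi)=(0,0)\},$$ $$\tilde G^\mu_{\mathcal I}=\{\tilde\phi\in\mathrm{Homeo}_0(\mathbb{R}^2) : \tilde\phi\text{ is a lift of some }\phi\in G_0\text{ and }\rho_\mu(\tilde\phi)=(0,0)\}.$$ A lift of a subgroup $H$ of $\mathrm{Homeo}(\mathbb{T}^2)$ is a subgroup $\tilde H$ of $\mathrm{Homeo}(\mathbb{R}^2)$ such that every element of $\tilde H$ is a lift of an element of $H$ and the natural projection $\tilde H\to H$, $\tilde\phi\mapsto\phi$, is a group isomorphism. **Proposition.** Let $G$ be a nilpotent subgroup of $\mathrm{Homeo}(\mathbb{T}^2)$ and let $\psi\in G$ satisfy $L(\psi)\neq 0$. Fix a lift $\tilde\psi$ of $\psi$ and $\mu\in\mathcal{P}(G)$. Let $H$ be a normal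 subgroup of $G$ with $H\subset G_0$. Then $H$ has a lift $\tilde H$ such that $\tilde\psi\tilde H\tilde\psi^{-1}=\tilde H$ if and only if $H\subset G^\mu_{\mathcal I}$. Moreover, every lift $\tilde H$ of $H$ with $\tilde\psi\tilde H\tilde\psi^{-1}=\tilde H$ satisfies $\tilde H\subset\tilde G^\mu_{\mathcal I}$. -/

import Mathlib

namespace NilpotentTorus

open MeasureTheory CategoryTheory

/-- The torus `𝕋² = ℝ²/ℤ² = ℝ/ℤ × ℝ/ℤ`. -/
abbrev Torus : Type := UnitAddCircle × UnitAddCircle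

/-- The plane `ℝ²`, the universal covering space of the torus. -/
abbrev Plane : Type := ℝ × ℝ

/-- The universal covering map `π : ℝ² → 𝕋²`. -/
def proj (x : Plane) : Torus := ((x.1 : UnitAddCircle), (x.2 : UnitAddCircle))

/-- The homeomorphism `F` of the plane is a lift of the homeomorphism `f` of the torus. -/
def IsLift (F : Plane ≃ₜ Plane) (f : Torus ≃ₜ Torus) : Prop :=
  ∀ x, proj (F x) = f (proj x)

/-- `f` is isotopic to the identity, i.e. `f ∈ Homeo₀(X)`: there is a jointly continuous path of
homeomorphisms of `X` from the identity to `f`. -/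
def IsotopicToId {X : Type*} [TopologicalSpace X] (f : X ≃ₜ X) : Prop :=
  ∃ γ : unitInterval → (X ≃ₜ X),
    Continuous (fun p : unitInterval × X => γ p.1 p.2) ∧ γ 0 = 1 ∧ γ 1 = f

/-- The Lefschetz number `L(f) = ∑ (-1)ⁿ tr (f_* : Hₙ(𝕋²; ℚ) → Hₙ(𝕋²; ℚ))`, where `Hₙ` is singular
homology. As the torus is a manifold of dimension two, only the degrees `0, 1, 2` occur. -/
noncomputable def lefschetzNumber (f : C(Torus, Torus)) : ℚ :=
  ∑ n ∈ Finset.range 3, (-1 : ℚ) ^ n *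
    LinearMap.trace ℚ _
      (((AlgebraicTopology.singularHomologyFunctor (ModuleCat.{0} ℚ) n).obj
        (ModuleCat.of ℚ ℚ)).map (TopCat.ofHom f)).hom

/-- The section of `π : ℝ² → 𝕋²` with values in `[0,1) × [0,1)`. -/
noncomputable def fundamentalSection (z : Torus) : Plane :=
  ((AddCircle.equivIco 1 0 z.1 : ℝ), (AddCircle.equivIco 1 0 z.2 : ℝ))

/-- The map `𝕋² → ℝ²` induced by `F - Id`, for a homeomorphism `F` of the plane that commutes with
the integer translations; see `displacement_proj`. -/
noncomputable def displacement (F : Plane ≃ₜ Plane) (z : Torus) : Plane :=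
  F (fundamentalSection z) - fundamentalSection z

theorem proj_fundamentalSection (z : Torus) : proj (fundamentalSection z) = z :=
  Prod.ext ((AddCircle.equivIco 1 0).symm_apply_apply z.1)
    ((AddCircle.equivIco 1 0).symm_apply_apply z.2)

/-- If `F` commutes with the integer translations, then `displacement F` is the map to which
`F - Id` descends. -/
theorem displacement_proj (F : Plane ≃ₜ Plane)
    (hF : ∀ (x : Plane) (m n : ℤ), F (x + ((m : ℝ), (n : ℝ))) = F x + ((m : ℝ), (n : ℝ)))
    (x : Plane) : displacement F (proj x) = F x - x := by
  have h := proj_fundamentalSection (proj x)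
  obtain ⟨m, hm⟩ := (AddCircle.coe_eq_zero_iff (p := (1 : ℝ))).1
    (sub_eq_zero.2 (congrArg Prod.fst h))
  obtain ⟨n, hn⟩ := (AddCircle.coe_eq_zero_iff (p := (1 : ℝ))).1
    (sub_eq_zero.2 (congrArg Prod.snd h))
  have hs : fundamentalSection (proj x) = x + ((m : ℝ), (n : ℝ)) := by
    refine Prod.ext ?_ ?_
    · simpa using (eq_add_of_sub_eq' (by simpa using hm.symm))
    · simpa using (eq_add_of_sub_eq' (by simpa using hn.symm))
  rw [displacement, hs, hF, add_sub_add_right_eq_sub]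

/-- The `μ`-rotation vector `ρ_μ(F) = ∫ (F - Id) dμ` of a lift `F` of a homeomorphism of the torus
that is isotopic to the identity. -/
noncomputable def rotationVector (μ : Measure Torus) (F : Plane ≃ₜ Plane) : Plane :=
  ∫ z, displacement F z ∂μ

/-- `𝒫(G)`: the `G`-invariant Borel probability measures on the torus. -/
def invariantMeasures (G : Subgroup (Torus ≃ₜ Torus)) : Set (Measure Torus) :=
  {μ | IsProbabilityMeasure μ ∧ ∀ g ∈ G, μ.map g = μ}

/-- `G₀`: the elements of `G` that are isotopic to the identity. -/
def isotopicPart (G : Subgroup (Torus ≃ₜ Torus)) : Set (Torus ≃ₜ Torus) :=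
  {φ | φ ∈ G ∧ IsotopicToId φ}

/-- `G_I^μ`: the elements of `G₀` that have a lift with zero `μ`-rotation vector. -/
def irrotational (G : Subgroup (Torus ≃ₜ Torus)) (μ : Measure Torus) : Set (Torus ≃ₜ Torus) :=
  {φ | φ ∈ isotopicPart G ∧ ∃ F : Plane ≃ₜ Plane, IsLift F φ ∧ rotationVector μ F = 0}

/-- `G̃_I^μ`: the elements of `Homeo₀(ℝ²)` that are lifts of elements of `G₀` and have zero
`μ`-rotation vector. -/
def irrotationalLifts (G : Subgroup (Torus ≃ₜ Torus)) (μ : Measure Torus) :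
    Set (Plane ≃ₜ Plane) :=
  {F | IsotopicToId F ∧ (∃ φ ∈ isotopicPart G, IsLift F φ) ∧ rotationVector μ F = 0}

/-- The group `K` of homeomorphisms of the plane is a lift of the group `H` of homeomorphisms of the
torus: every element of `K` is a lift of an element of `H`, and the natural projection `κ : K → H`
is an isomorphism of groups. -/
def IsGroupLift (K : Subgroup (Plane ≃ₜ Plane)) (H : Subgroup (Torus ≃ₜ Torus)) : Prop :=
  ∃ κ : K ≃* H, ∀ F : K, IsLift F (κ F)

/-- `Ψ K Ψ⁻¹ = K`. -/
def NormalizedBy (K : Subgroup (Plane ≃ₜ Plane)) (Ψ : Plane ≃ₜ Plane) : Prop :=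
  (fun F => Ψ * F * Ψ⁻¹) '' (K : Set (Plane ≃ₜ Plane)) = K

end NilpotentTorus

open NilpotentTorus

/-! A lift `Ψ` of `ψ` acts on the lattice by an integer matrix `A`. On lifts of elements of `G₀`,
the rotation vector is additive (`rotationVector_mul`), and conjugating by `Ψ` multiplies it by `A`
(`rotationVector_conj`). So the commutator of `Ψ` with `F` has rotation vector `(A - I) ρ(F)`. If
`K` is a lift of `H` normalized by `Ψ`, iterated commutators stay in `K` while their projections
descend the lower central series of `G`. After finitely many steps the projection is trivial, hence
so is the element of `K`, and `(A - I)^N ρ(F) = 0`. As `A - I` is invertible, `ρ(F) = 0`.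
Conversely, an element of `H` has at most one lift with zero rotation vector; when all have one,
these lifts form a group, and conjugation by `Ψ` preserves it.

It remains to see that `L(ψ) ≠ 0` makes `A - I` invertible
(`det_ne_zero_of_lefschetzNumber_ne_zero`). Otherwise `A` fixes a primitive integer vector, and
after a unimodular change of coordinates this is `(1, 0)`. The lift then descends to a map `E` of
the cylinder `S¹ × ℝ` that is homotopic to the identity, and `E ∘ T = T^d ∘ E` with `d = ±1` for the
deck shift `T`. The sequence `0 → C(S¹ × ℝ) → C(S¹ × ℝ) → C(𝕋²) → 0` with first map `T - 1` is
exact, and `T - 1` vanishes on homology. Hence the traces on `H₀, H₁, H₂` of the torus are `1, 1 +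
d, d`, with alternating sum zero. -/

namespace NilpotentTorus

open CategoryTheory Limits Simplicial

/-! ### Free orbits and exactness on finitely supported functions -/

section Exactness

variable {α β : Type} {τ : α → α} {p : α → β}

/-- A function in the kernel is constant along forward `τ`-orbits. These are infinite, so finite
support forces it to vanish. -/
theorem mapDomain_sub_id_injective (hinj : Function.Injective τ)
    (hfree : ∀ (k : ℕ) a, τ^[k] a = a → k = 0) :
    Function.Injective (Finsupp.lmapDomain ℚ ℚ τ - (LinearMap.id : (α →₀ ℚ) →ₗ[ℚ] (α →₀ ℚ))) := by
  rw [injective_iff_map_eq_zero]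
  intro c hc
  have hc' : Finsupp.mapDomain τ c = c := by
    simpa [sub_eq_zero] using hc
  have hstep : ∀ a, c (τ a) = c a := fun a => by
    conv_lhs => rw [← hc']
    exact Finsupp.mapDomain_apply hinj c a
  by_contra hne
  obtain ⟨a, ha⟩ := Finsupp.ne_iff.1 hne
  have hiter : ∀ k : ℕ, c (τ^[k] a) = c a := by
    intro k
    induction k with
    | zero => rfl
    | succ k ih => rw [Function.iterate_succ_apply', hstep, ih]
  have hin : Function.Injective fun k : ℕ => τ^[k] a := by
    intro k l hkl
    wlog h : k ≤ l generalizing k l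
    · exact (this hkl.symm (by omega)).symm
    obtain ⟨m, rfl⟩ := Nat.exists_eq_add_of_le h
    have : τ^[k] (τ^[m] a) = τ^[k] a := by
      rw [← Function.iterate_add_apply]; exact hkl.symm
    have := hfree m a (hinj.iterate k this)
    omega
  refine Set.infinite_range_of_injective hin (c.hasFiniteSupport.subset ?_)
  rintro _ ⟨k, rfl⟩
  simpa [hiter k] using ha

/-- Modulo the image of `τ - 1`, all points of a fibre of `p` have the same class. So the quotient
map factors through `p`, via any section, and kills whatever `p` kills. -/
theorem exact_mapDomain (hp : Function.Surjective p)
    (hτ : ∀ a, p (τ a) = p a)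
    (hfib : ∀ a b, p a = p b → ∃ k : ℕ, b = τ^[k] a ∨ a = τ^[k] b) :
    Function.Exact (Finsupp.lmapDomain ℚ ℚ τ - (LinearMap.id : (α →₀ ℚ) →ₗ[ℚ] (α →₀ ℚ))) (Finsupp.lmapDomain ℚ ℚ p) := by
  set T := Finsupp.lmapDomain ℚ ℚ τ - (LinearMap.id : (α →₀ ℚ) →ₗ[ℚ] (α →₀ ℚ)) with hT
  have hstep : ∀ a, Finsupp.single (τ a) (1 : ℚ) - Finsupp.single a 1 ∈ LinearMap.range T :=
    fun a => ⟨Finsupp.single a 1, by simp [hT]⟩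
  have hiter : ∀ (k : ℕ) a,
      Finsupp.single (τ^[k] a) (1 : ℚ) - Finsupp.single a 1 ∈ LinearMap.range T := by
    intro k a
    induction k with
    | zero => simp
    | succ k ih =>
      have := add_mem (hstep (τ^[k] a)) ih
      rwa [sub_add_sub_cancel, ← Function.iterate_succ_apply' τ] at this
  let s := Function.surjInv hp
  let σ : (β →₀ ℚ) →ₗ[ℚ] (α →₀ ℚ) ⧸ LinearMap.range T :=
    (LinearMap.range T).mkQ ∘ₗ Finsupp.lmapDomain ℚ ℚ s
  have hσ : σ ∘ₗ Finsupp.lmapDomain ℚ ℚ p = (LinearMap.range T).mkQ := by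
    ext a
    simp only [σ, LinearMap.comp_apply, Finsupp.lsingle_apply, Finsupp.lmapDomain_apply,
      Finsupp.mapDomain_single]
    rw [Submodule.mkQ_apply, Submodule.mkQ_apply, Submodule.Quotient.eq]
    obtain ⟨k, hk | hk⟩ := hfib a (s (p a)) (Function.surjInv_eq hp (p a)).symm
    · rw [hk]; exact hiter k a
    · rw [← neg_mem_iff, neg_sub]
      nth_rewrite 1 [hk]
      exact hiter k _
  rw [LinearMap.exact_iff]
  apply le_antisymm
  · intro c hc
    rw [LinearMap.mem_ker] at hc
    have := LinearMap.congr_fun hσ c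
    rw [LinearMap.comp_apply, hc, map_zero] at this
    exact (Submodule.Quotient.mk_eq_zero _).1 this.symm
  · rintro _ ⟨c, rfl⟩
    rw [LinearMap.mem_ker]
    have : Finsupp.lmapDomain ℚ ℚ p ∘ₗ T = 0 := by
      ext a : 2
      simp only [hT, LinearMap.comp_apply, LinearMap.sub_apply, Finsupp.lsingle_apply,
      LinearMap.id_apply, map_sub, Finsupp.lmapDomain_apply, Finsupp.mapDomain_single, hτ, sub_self,
      LinearMap.zero_apply]
    exact LinearMap.congr_fun this c

end Exactness

/-! ### Rational simplicial chains and the orbit sequence -/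

section Chains

/-- The canonical map from the rational `n`-chains to the finitely supported functions on the
`n`-simplices. -/
noncomputable def chainsToFinsupp (X : SSet.{0}) (n : ℕ) :
    (X.chainComplex (ModuleCat.of ℚ ℚ)).X n ⟶ ModuleCat.of ℚ (X _⦋n⦌ →₀ ℚ) :=
  Cofan.IsColimit.desc (X.isColimitChainComplexXCofan (ModuleCat.of ℚ ℚ) n)
    (fun x => ModuleCat.ofHom (Finsupp.lsingle x))

theorem ι_chainsToFinsupp (X : SSet.{0}) (n : ℕ) (x : X _⦋n⦌) :
    X.ιChainComplex x ≫ chainsToFinsupp X n = ModuleCat.ofHom (Finsupp.lsingle x) :=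
  Cofan.IsColimit.fac (X.isColimitChainComplexXCofan (ModuleCat.of ℚ ℚ) n) _ x

/-- The inverse of `chainsToFinsupp`. -/
noncomputable def finsuppToChains (X : SSet.{0}) (n : ℕ) :
    ModuleCat.of ℚ (X _⦋n⦌ →₀ ℚ) ⟶ (X.chainComplex (ModuleCat.of ℚ ℚ)).X n :=
  ModuleCat.ofHom (Finsupp.lsum ℚ fun x => (X.ιChainComplex (R := ModuleCat.of ℚ ℚ) x).hom)

theorem single_finsuppToChains (X : SSet.{0}) (n : ℕ) (x : X _⦋n⦌) :
    ModuleCat.ofHom (Finsupp.lsingle x) ≫ finsuppToChains X n = X.ιChainComplex x := by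
  refine ModuleCat.hom_ext (LinearMap.ext fun r => ?_)
  change (Finsupp.lsum ℚ fun x => (X.ιChainComplex (R := ModuleCat.of ℚ ℚ) x).hom)
    (Finsupp.single x r) = _
  simp

/-- The rational `n`-chains of a simplicial set are the finitely supported functions on its
`n`-simplices. -/
noncomputable def chainsIso (X : SSet.{0}) (n : ℕ) :
    ModuleCat.of ℚ (X _⦋n⦌ →₀ ℚ) ≅ (X.chainComplex (ModuleCat.of ℚ ℚ)).X n where
  hom := finsuppToChains X n
  inv := chainsToFinsupp X n
  hom_inv_id := by
    refine ModuleCat.hom_ext (Finsupp.lhom_ext' fun x => ?_)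
    have h : (ModuleCat.ofHom (Finsupp.lsingle x) : ModuleCat.of ℚ ℚ ⟶ _) ≫
        finsuppToChains X n ≫ chainsToFinsupp X n = ModuleCat.ofHom (Finsupp.lsingle x) := by
      rw [← Category.assoc, single_finsuppToChains, ι_chainsToFinsupp]
    exact congrArg ModuleCat.Hom.hom h
  inv_hom_id := by
    refine SSet.chainComplex_hom_ext fun x => ?_
    rw [← Category.assoc, ι_chainsToFinsupp, single_finsuppToChains, Category.comp_id]

/-- `chainsIso` as a linear equivalence. -/
noncomputable def chainsEquiv (X : SSet.{0}) (n : ℕ) :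
    (X _⦋n⦌ →₀ ℚ) ≃ₗ[ℚ] ((X.chainComplex (ModuleCat.of ℚ ℚ)).X n : Type) :=
  (chainsIso X n).toLinearEquiv

theorem chainsEquiv_single (X : SSet.{0}) (n : ℕ) (x : X _⦋n⦌) (r : ℚ) :
    chainsEquiv X n (Finsupp.single x r) =
      (X.ιChainComplex (R := ModuleCat.of ℚ ℚ) x).hom r := by
  change (Finsupp.lsum ℚ fun x => (X.ιChainComplex (R := ModuleCat.of ℚ ℚ) x).hom)
    (Finsupp.single x r) = _
  simp

theorem chainComplexMap_chainsEquiv {X Y : SSet.{0}} (f : X ⟶ Y) (n : ℕ)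
    (c : X _⦋n⦌ →₀ ℚ) :
    ((SSet.chainComplexMap f (ModuleCat.of ℚ ℚ)).f n).hom (chainsEquiv X n c) =
      chainsEquiv Y n (Finsupp.lmapDomain ℚ ℚ (f.app _) c) := by
  have : ((SSet.chainComplexMap f (ModuleCat.of ℚ ℚ)).f n).hom ∘ₗ
        (chainsEquiv X n).toLinearMap =
      (chainsEquiv Y n).toLinearMap ∘ₗ Finsupp.lmapDomain ℚ ℚ (f.app _) := by
    ext x : 2
    simp only [LinearMap.comp_apply, LinearEquiv.coe_coe, Finsupp.lsingle_apply,
      Finsupp.lmapDomain_apply, Finsupp.mapDomain_single, chainsEquiv_single]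
    exact ConcreteCategory.congr_hom (SSet.ι_chainComplexMap_f X Y f (ModuleCat.of ℚ ℚ) x) (1 : ℚ)
  exact LinearMap.congr_fun this c

/-- The sequence of chain complexes `C(X) → C(X) → C(Y)` attached to a map `q : X ⟶ Y` which is
invariant under `t : X ⟶ X`; the first map is `t - 1`. -/
noncomputable def orbitSequence {X Y : SSet.{0}} (t : X ⟶ X) (q : X ⟶ Y) (h : t ≫ q = q) :
    ShortComplex (ChainComplex (ModuleCat.{0} ℚ) ℕ) :=
  ShortComplex.mk (SSet.chainComplexMap t (ModuleCat.of ℚ ℚ) - 𝟙 _)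
    (SSet.chainComplexMap q (ModuleCat.of ℚ ℚ))
    (by rw [Preadditive.sub_comp, Category.id_comp, SSet.chainComplexMap, SSet.chainComplexMap,
          ← Functor.map_comp, h, sub_self])

theorem orbitSequence_shortExact {X Y : SSet.{0}} (t : X ⟶ X) (q : X ⟶ Y) (h : t ≫ q = q)
    (hinj : ∀ n : ℕ, Function.Injective fun x : X _⦋n⦌ => t.app _ x)
    (hfree : ∀ (n k : ℕ) (x : X _⦋n⦌), (fun y : X _⦋n⦌ => t.app _ y)^[k] x = x → k = 0)
    (hsurj : ∀ n : ℕ, Function.Surjective fun x : X _⦋n⦌ => q.app _ x)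
    (hfib : ∀ (n : ℕ) (x y : X _⦋n⦌), q.app _ x = q.app _ y →
      ∃ k : ℕ, y = (fun z : X _⦋n⦌ => t.app _ z)^[k] x ∨
        x = (fun z : X _⦋n⦌ => t.app _ z)^[k] y) :
    (orbitSequence t q h).ShortExact := by
  have hf : ∀ (n : ℕ) c, ((orbitSequence t q h).f.f n).hom (chainsEquiv X n c) =
      chainsEquiv X n
        ((Finsupp.lmapDomain ℚ ℚ (fun x : X _⦋n⦌ => t.app _ x) -
          (LinearMap.id : (X _⦋n⦌ →₀ ℚ) →ₗ[ℚ] _)) c) := by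
    intro n c
    have := chainComplexMap_chainsEquiv t n c
    rw [LinearMap.sub_apply, map_sub]
    exact congrArg (· - chainsEquiv X n c) this
  have hg : ∀ (n : ℕ) c, ((orbitSequence t q h).g.f n).hom (chainsEquiv X n c) =
      chainsEquiv Y n (Finsupp.lmapDomain ℚ ℚ (fun x : X _⦋n⦌ => q.app _ x) c) :=
    fun n c => chainComplexMap_chainsEquiv q n c
  have key : ∀ n, ((orbitSequence t q h).map
      (HomologicalComplex.eval (ModuleCat ℚ) _ n)).ShortExact := by
    intro n
    have hm : Mono ((orbitSequence t q h).f.f n) := by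
      rw [ModuleCat.mono_iff_injective]
      intro a b hab
      obtain ⟨a, rfl⟩ := (chainsEquiv X n).surjective a
      obtain ⟨b, rfl⟩ := (chainsEquiv X n).surjective b
      have hab' := (hf n a).symm.trans (hab.trans (hf n b))
      exact congrArg _ (mapDomain_sub_id_injective (hinj n) (hfree n)
        ((chainsEquiv X n).injective hab'))
    have he : Epi ((orbitSequence t q h).g.f n) := by
      rw [ModuleCat.epi_iff_surjective]
      intro c
      obtain ⟨c, rfl⟩ := (chainsEquiv Y n).surjective c
      obtain ⟨b, rfl⟩ := Finsupp.mapDomain_surjective (hsurj n) c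
      exact ⟨chainsEquiv X n b, hg n b⟩
    refine ShortComplex.ShortExact.mk' ?_ hm he
    rw [ShortComplex.ShortExact.moduleCat_exact_iff_function_exact]
    intro c
    obtain ⟨c, rfl⟩ := (chainsEquiv X n).surjective c
    have hex := exact_mapDomain (hsurj n) (τ := fun x : X _⦋n⦌ => t.app _ x)
      (fun a => congrArg (fun r : X ⟶ Y => r.app _ a) h) (hfib n)
    constructor
    · intro hc
      have := (hg n c).symm.trans hc
      obtain ⟨b, hb⟩ := (hex c).1 ((LinearEquiv.map_eq_zero_iff _).1 this)
      exact ⟨chainsEquiv X n b, (hf n b).trans (congrArg _ hb)⟩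
    · rintro ⟨b, hb⟩
      obtain ⟨b, rfl⟩ := (chainsEquiv X n).surjective b
      have := (hf n b).symm.trans hb
      refine (hg n c).trans ?_
      rw [← (chainsEquiv X n).injective this, (hex _).2 ⟨b, rfl⟩, map_zero]
      rfl
  exact HomologicalComplex.shortExact_of_degreewise_shortExact _ key

end Chains

end NilpotentTorus

namespace NilpotentTorus

open CategoryTheory Limits Simplicial

/-! ### Additivity of the trace -/

section Trace

variable {K V₁ V₂ V₃ : Type*} [Field K] [AddCommGroup V₁] [Module K V₁] [AddCommGroup V₂]
  [Module K V₂] [AddCommGroup V₃] [Module K V₃]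

/-- A splitting of `p` identifies `V₂` with `V₁ × V₃`. There `b` is block triangular with diagonal
blocks `a` and `c`. -/
theorem finite_and_trace_eq_of_exact [FiniteDimensional K V₁] [FiniteDimensional K V₃]
    {i : V₁ →ₗ[K] V₂} {p : V₂ →ₗ[K] V₃} (hi : Function.Injective i)
    (hp : Function.Surjective p) (hip : Function.Exact i p) :
    FiniteDimensional K V₂ ∧ ∀ (a : V₁ →ₗ[K] V₁) (b : V₂ →ₗ[K] V₂) (c : V₃ →ₗ[K] V₃),
      b ∘ₗ i = i ∘ₗ a → c ∘ₗ p = p ∘ₗ b →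
      LinearMap.trace K V₂ b = LinearMap.trace K V₁ a + LinearMap.trace K V₃ c := by
  obtain ⟨s, hs⟩ := p.exists_rightInverse_of_surjective (LinearMap.range_eq_top.2 hp)
  have hs' : ∀ y, p (s y) = y := LinearMap.congr_fun hs
  have hpi : ∀ x, p (i x) = 0 := fun x => (hip _).2 ⟨x, rfl⟩
  let e : (V₁ × V₃) ≃ₗ[K] V₂ := LinearEquiv.ofBijective (i.coprod s) <| by
    constructor
    · rw [injective_iff_map_eq_zero]
      rintro ⟨x, y⟩ hxy
      have hy : y = 0 := by simpa [hpi, hs'] using congrArg p hxy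
      subst hy
      have : i x = i 0 := by simpa using hxy
      rw [hi this]; rfl
    · intro z
      obtain ⟨x, hx⟩ := (hip (z - s (p z))).1 (by simp [hs'])
      exact ⟨(x, p z), by simp [hx]⟩
  have he : ∀ x y, e (x, y) = i x + s y := fun x y => LinearMap.coprod_apply i s (x, y)
  refine ⟨Module.Finite.equiv e, fun a b c hab hbc => ?_⟩
  have hab' : ∀ x, b (i x) = i (a x) := LinearMap.congr_fun hab
  have hbc' : ∀ x, c (p x) = p (b x) := LinearMap.congr_fun hbc
  -- The off-diagonal block of `b`; it contributes nothing to the trace.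
  let r : V₃ →ₗ[K] V₁ := LinearMap.fst K V₁ V₃ ∘ₗ e.symm.toLinearMap ∘ₗ b ∘ₗ s
  have hr : ∀ y, b (s y) = i (r y) + s (c y) := by
    intro y
    have h1 : b (s y) = e (e.symm (b (s y))) := (e.apply_symm_apply _).symm
    have h2 : (e.symm (b (s y))).2 = c y := by
      have := congrArg p h1
      rw [← Prod.mk.eta (p := e.symm (b (s y))), he, map_add, hpi, hs', ← hbc', hs'] at this
      simpa using this.symm
    rw [← Prod.mk.eta (p := e.symm (b (s y))), he, h2] at h1
    exact h1
  have hconj : b = e.conj (LinearMap.prodMap a c +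
      LinearMap.inl K V₁ V₃ ∘ₗ (r ∘ₗ LinearMap.snd K V₁ V₃)) := by
    ext z
    obtain ⟨⟨x, y⟩, rfl⟩ := e.surjective z
    rw [LinearEquiv.conj_apply_apply, e.symm_apply_apply, he, map_add, hr, hab',
      show (LinearMap.prodMap a c + LinearMap.inl K V₁ V₃ ∘ₗ (r ∘ₗ LinearMap.snd K V₁ V₃)) (x, y) =
        (a x + r y, c y) by simp, he, map_add, add_assoc]
  rw [hconj, LinearMap.trace_conj', map_add, LinearMap.trace_prodMap', LinearMap.trace_comp_comm',
    LinearMap.comp_assoc, LinearMap.snd_comp_inl, LinearMap.comp_zero, map_zero, add_zero]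

end Trace

/-! ### Traces in the long exact sequence -/

section LongExact

variable {S : ShortComplex (ChainComplex (ModuleCat.{0} ℚ) ℕ)}

/-- Since `S.f` is zero on homology, the long exact sequence breaks into `0 → Hₙ₊₁(X₂) → Hₙ₊₁(X₃) →
Hₙ(X₁) → 0`, naturally in `S`. -/
theorem trace_homologyMap_succ (hS : S.ShortExact)
    (h0 : ∀ n, HomologicalComplex.homologyMap S.f n = 0) (n : ℕ)
    [FiniteDimensional ℚ (S.X₂.homology (n + 1))] [FiniteDimensional ℚ (S.X₁.homology n)] :
    FiniteDimensional ℚ (S.X₃.homology (n + 1)) ∧ ∀ φ : S ⟶ S,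
      LinearMap.trace ℚ _ (HomologicalComplex.homologyMap φ.τ₃ (n + 1)).hom =
        LinearMap.trace ℚ _ (HomologicalComplex.homologyMap φ.τ₂ (n + 1)).hom +
        LinearMap.trace ℚ _ (HomologicalComplex.homologyMap φ.τ₁ n).hom := by
  have hr : (ComplexShape.down ℕ).Rel (n + 1) n := rfl
  have e1 := hS.homology_exact₁ (n + 1) n hr
  have e2 := hS.homology_exact₂ (n + 1)
  have e3 := hS.homology_exact₃ (n + 1) n hr
  have hi : Function.Injective (HomologicalComplex.homologyMap S.g (n + 1)).hom := by
    rw [← ModuleCat.mono_iff_injective]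
    exact (ShortComplex.exact_iff_mono _ (h0 (n + 1))).1 e2
  have hp : Function.Surjective (hS.δ (n + 1) n hr).hom := by
    rw [← ModuleCat.epi_iff_surjective]
    exact (ShortComplex.exact_iff_epi _ (h0 n)).1 e1
  have hip := (ShortComplex.ShortExact.moduleCat_exact_iff_function_exact _).1 e3
  obtain ⟨hfin, htr⟩ := finite_and_trace_eq_of_exact hi hp hip
  refine ⟨hfin, fun φ => htr _ _ _ ?_ ?_⟩
  · have : HomologicalComplex.homologyMap S.g (n + 1) ≫
        HomologicalComplex.homologyMap φ.τ₃ (n + 1) =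
        HomologicalComplex.homologyMap φ.τ₂ (n + 1) ≫
        HomologicalComplex.homologyMap S.g (n + 1) := by
      rw [← HomologicalComplex.homologyMap_comp, ← HomologicalComplex.homologyMap_comp, φ.comm₂₃]
    exact congrArg ModuleCat.Hom.hom this
  · exact congrArg ModuleCat.Hom.hom
      (HomologicalComplex.HomologySequence.δ_naturality φ hS hS (n + 1) n hr)

theorem trace_homologyMap_zero (hS : S.ShortExact)
    (h0 : HomologicalComplex.homologyMap S.f 0 = 0) :
    ∀ φ : S ⟶ S, LinearMap.trace ℚ _ (HomologicalComplex.homologyMap φ.τ₃ 0).hom =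
      LinearMap.trace ℚ _ (HomologicalComplex.homologyMap φ.τ₂ 0).hom := by
  have hm : Mono (HomologicalComplex.homologyMap S.g 0) :=
    (ShortComplex.exact_iff_mono _ h0).1 (hS.homology_exact₂ 0)
  have he : Epi (HomologicalComplex.homologyMap S.g 0) := by
    have := hS.epi_g
    exact HomologicalComplex.epi_homologyMap_of_epi_of_not_rel S.g 0 (by simp)
  have := isIso_of_mono_of_epi (HomologicalComplex.homologyMap S.g 0)
  let e := (asIso (HomologicalComplex.homologyMap S.g 0)).toLinearEquiv
  intro φ
  have h : HomologicalComplex.homologyMap S.g 0 ≫ HomologicalComplex.homologyMap φ.τ₃ 0 =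
      HomologicalComplex.homologyMap φ.τ₂ 0 ≫ HomologicalComplex.homologyMap S.g 0 := by
    rw [← HomologicalComplex.homologyMap_comp, ← HomologicalComplex.homologyMap_comp, φ.comm₂₃]
  have : (HomologicalComplex.homologyMap φ.τ₃ 0).hom =
      e.conj (HomologicalComplex.homologyMap φ.τ₂ 0).hom := by
    ext z
    obtain ⟨y, rfl⟩ := e.surjective z
    rw [LinearEquiv.conj_apply_apply, LinearEquiv.symm_apply_apply]
    exact ConcreteCategory.congr_hom h y
  rw [this, LinearMap.trace_conj']

end LongExact

/-! ### Lifting maps from contractible spaces to the line -/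

section Lifting

theorem exists_int_const {A : Type*} [TopologicalSpace A] [PreconnectedSpace A] {f : A → ℝ}
    (hf : Continuous f) (h : ∀ a, ∃ k : ℤ, f a = k) : ∃ k : ℤ, ∀ a, f a = k := by
  choose g hg using h
  have hg' : Continuous g := by
    rw [Int.isClosedEmbedding_coe_real.isInducing.continuous_iff]
    exact hf.congr hg
  rcases isEmpty_or_nonempty A with hA | ⟨⟨a⟩⟩
  · exact ⟨0, fun a => hA.elim a⟩
  · exact ⟨g a, fun b => by rw [hg, PreconnectedSpace.constant ‹_› hg' (x := b) (y := a)]⟩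

theorem exists_int_of_coe_eq {x y : ℝ} (h : (x : UnitAddCircle) = y) : ∃ k : ℤ, y - x = k := by
  obtain ⟨k, hk⟩ := (AddCircle.coe_eq_zero_iff (p := (1 : ℝ)) (x := y - x)).1
    (by rw [AddCircle.coe_sub, h, sub_self])
  exact ⟨k, by simpa using hk.symm⟩

theorem coe_int_circle (k : ℤ) : ((k : ℝ) : UnitAddCircle) = 0 :=
  (AddCircle.coe_eq_zero_iff (p := (1 : ℝ))).2 ⟨k, by simp⟩

/-- A contraction run backwards is a homotopy from a constant map to `σ`. The constant lifts, and
the end of the lifted homotopy lifts `σ`. -/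
theorem exists_lift_circle {A : Type*} [TopologicalSpace A] [ContractibleSpace A]
    (σ : C(A, UnitAddCircle)) : ∃ s : C(A, ℝ), ∀ a, (s a : UnitAddCircle) = σ a := by
  obtain ⟨a₀, ⟨H⟩⟩ := (id_nullhomotopic A)
  obtain ⟨r, hr⟩ := QuotientAddGroup.mk_surjective (σ a₀)
  have cov := AddCircle.isCoveringMap_coe (1 : ℝ)
  let G : C(unitInterval × A, UnitAddCircle) := σ.comp H.symm.toContinuousMap
  have hG0 : ∀ a, G (0, a) = ((ContinuousMap.const A r a : ℝ) : UnitAddCircle) := fun a => by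
    change σ (H.symm (0, a)) = _
    rw [H.symm.apply_zero]
    exact hr.symm
  refine ⟨(cov.liftHomotopy G (ContinuousMap.const A r) hG0).comp
    ⟨fun a => (1, a), by fun_prop⟩, fun a => ?_⟩
  have := congrFun (cov.liftHomotopy_lifts G (ContinuousMap.const A r) hG0) (1, a)
  refine this.trans ?_
  change σ (H.symm (1, a)) = _
  rw [H.symm.apply_one]
  rfl

end Lifting

end NilpotentTorus

namespace NilpotentTorus

open CategoryTheory Limits Simplicial

/-! ### Rational singular homology: homotopy invariance, contractible spaces, degree zero -/

section Homology

/-- Rational singular homology. -/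
noncomputable abbrev ratHomology (n : ℕ) (X : TopCat.{0}) : ModuleCat.{0} ℚ :=
  ((AlgebraicTopology.singularHomologyFunctor (ModuleCat.{0} ℚ) n).obj (ModuleCat.of ℚ ℚ)).obj X

/-- The map induced on rational singular homology. -/
noncomputable abbrev ratHomologyMap (n : ℕ) {X Y : TopCat.{0}} (f : X ⟶ Y) :
    ratHomology n X ⟶ ratHomology n Y :=
  ((AlgebraicTopology.singularHomologyFunctor (ModuleCat.{0} ℚ) n).obj (ModuleCat.of ℚ ℚ)).map f

/-- The map induced on rational singular chains. -/
noncomputable abbrev ratChainMap {X Y : TopCat.{0}} (f : X ⟶ Y) :=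
  SSet.chainComplexMap (TopCat.toSSet.map f) (ModuleCat.of ℚ ℚ)

theorem ratChainMap_comp {X Y Z : TopCat.{0}} (f : X ⟶ Y) (g : Y ⟶ Z) :
    ratChainMap (f ≫ g) = ratChainMap f ≫ ratChainMap g := by
  simp only [ratChainMap, SSet.chainComplexMap, Functor.map_comp]

theorem ratHomologyMap_congr (n : ℕ) {X Y : TopCat.{0}} {f g : X ⟶ Y}
    (h : (TopCat.Hom.hom f).Homotopic (TopCat.Hom.hom g)) :
    ratHomologyMap n f = ratHomologyMap n g :=
  TopCat.Homotopy.congr_homologyMap_singularChainComplexFunctor h.some _ n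

/-- Up to homotopy the identity factors through a point. -/
theorem isZero_ratHomology_of_contractible (n : ℕ) (X : TopCat.{0}) [ContractibleSpace X] :
    IsZero (ratHomology (n + 1) X) := by
  obtain ⟨a, ha⟩ := id_nullhomotopic X
  let i : X ⟶ TopCat.of PUnit.{1} := TopCat.ofHom ⟨fun _ => PUnit.unit, continuous_const⟩
  let j : TopCat.of PUnit.{1} ⟶ X := TopCat.ofHom ⟨fun _ => a, continuous_const⟩
  have h1 : ratHomologyMap (n + 1) (𝟙 X) = ratHomologyMap (n + 1) (i ≫ j) :=
    ratHomologyMap_congr (n + 1) ha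
  have hz : IsZero (ratHomology (n + 1) (TopCat.of PUnit.{1})) := by
    have : TotallyDisconnectedSpace (TopCat.of PUnit.{1}) :=
      inferInstanceAs (TotallyDisconnectedSpace PUnit.{1})
    exact AlgebraicTopology.isZero_singularHomologyFunctor_of_totallyDisconnectedSpace _ _ _ _
      (Nat.succ_ne_zero n)
  rw [IsZero.iff_id_eq_zero]
  have h2 : ratHomologyMap (n + 1) (𝟙 X) = 𝟙 _ := CategoryTheory.Functor.map_id _ _
  have h3 : ratHomologyMap (n + 1) (i ≫ j) =
    ratHomologyMap (n + 1) i ≫ ratHomologyMap (n + 1) j := Functor.map_comp _ _ _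
  rw [← h2, h1, h3, hz.eq_of_tgt (ratHomologyMap (n + 1) i) 0, zero_comp]

theorem finrank_ratHomology_zero (X : TopCat.{0}) [PathConnectedSpace X] :
    FiniteDimensional ℚ (ratHomology 0 X) ∧ Module.finrank ℚ (ratHomology 0 X) = 1 := by
  let e : ratHomology 0 X ≃ₗ[ℚ] ℚ :=
    (asIso (X.singularHomology₀ε (ModuleCat.of ℚ ℚ))).toLinearEquiv
  exact ⟨Module.Finite.equiv e.symm, by rw [e.finrank_eq, Module.finrank_self]⟩

end Homology

/-! ### The infinite cyclic cover `Y × ℝ → Y × ℝ/ℤ` -/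

section Covering

variable (Y : Type) [TopologicalSpace Y]

/-- The generator of the deck transformations of `Y × ℝ → Y × ℝ/ℤ`. -/
def deckShift : TopCat.of (Y × ℝ) ⟶ TopCat.of (Y × ℝ) :=
  TopCat.ofHom ⟨fun z => (z.1, z.2 + 1), by fun_prop⟩

/-- The covering `Y × ℝ → Y × ℝ/ℤ`. -/
def circleCover : TopCat.of (Y × ℝ) ⟶ TopCat.of (Y × UnitAddCircle) :=
  TopCat.ofHom ⟨fun z => (z.1, (z.2 : UnitAddCircle)),
    continuous_fst.prodMk ((AddCircle.continuous_mk' 1).comp continuous_snd)⟩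

theorem deckShift_circleCover : deckShift Y ≫ circleCover Y = circleCover Y := by
  refine TopCat.hom_ext (ContinuousMap.ext fun z => Prod.ext rfl ?_)
  change ((z.2 + 1 : ℝ) : UnitAddCircle) = (z.2 : UnitAddCircle)
  rw [AddCircle.coe_add, AddCircle.coe_period, add_zero]

theorem deckShift_homotopic :
    (TopCat.Hom.hom (deckShift Y)).Homotopic (TopCat.Hom.hom (𝟙 (TopCat.of (Y × ℝ)))) :=
  ⟨{ toFun := fun p => (p.2.1, p.2.2 + (1 - (p.1 : ℝ)))
     continuous_toFun := by fun_prop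
     map_zero_left := fun z => Prod.ext rfl (by simp [deckShift])
     map_one_left := fun z => Prod.ext rfl (by simp) }⟩

/-- The sequence `0 → C(Y × ℝ) → C(Y × ℝ) → C(Y × ℝ/ℤ) → 0` of singular chain complexes. -/
noncomputable abbrev coverSequence : ShortComplex (ChainComplex (ModuleCat.{0} ℚ) ℕ) :=
  orbitSequence (TopCat.toSSet.map (deckShift Y)) (TopCat.toSSet.map (circleCover Y))
    (by rw [← Functor.map_comp, deckShift_circleCover])

instance (n : SimplexCategory) : ContractibleSpace (SimplexCategory.toTop.{0}.obj n) := by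
  have : ContractibleSpace (stdSimplex ℝ (Fin (n.len + 1))) :=
    (convex_stdSimplex ℝ _).contractibleSpace Set.Nonempty.of_subtype
  exact (Homeomorph.ulift (X := stdSimplex ℝ (Fin (n.len + 1)))).contractibleSpace

/-- The continuous map underlying a singular simplex. -/
noncomputable def simplexMap {X : TopCat.{0}} {n : ℕ} (x : (TopCat.toSSet.obj X) _⦋n⦌) :
    C(SimplexCategory.toTop.{0}.obj ⦋n⦌, X) :=
  TopCat.Hom.hom (X := SimplexCategory.toTop.{0}.obj ⦋n⦌) (Y := X) x.down

theorem simplex_ext {X : TopCat.{0}} {n : ℕ} {x y : (TopCat.toSSet.obj X) _⦋n⦌}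
    (h : ∀ a, simplexMap x a = simplexMap y a) : x = y :=
  ULift.ext _ _ (TopCat.hom_ext (ContinuousMap.ext h))

theorem toSSet_map_deckShift_iterate (n k : ℕ)
    (x : (TopCat.toSSet.obj (TopCat.of (Y × ℝ))) _⦋n⦌) (a : SimplexCategory.toTop.{0}.obj ⦋n⦌) :
    simplexMap ((fun y : (TopCat.toSSet.obj (TopCat.of (Y × ℝ))) _⦋n⦌ =>
      (TopCat.toSSet.map (deckShift Y)).app _ y)^[k] x) a =
      ((simplexMap x a).1, (simplexMap x a).2 + k) := by
  induction k with
  | zero => simp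
  | succ k ih =>
    rw [Function.iterate_succ_apply']
    refine (congrArg (fun z : Y × ℝ => (z.1, z.2 + 1)) ih).trans ?_
    simp [add_assoc]

/-- Standard simplices are contractible and connected, so singular simplices lift, and two lifts of
one simplex differ by a constant integer. The lifts thus form a free orbit of the deck shift. -/
theorem coverSequence_shortExact : (coverSequence Y).ShortExact := by
  refine orbitSequence_shortExact _ _ _ ?_ ?_ ?_ ?_
  · intro n x y hxy
    refine simplex_ext fun a => ?_
    have h : (((simplexMap x a).1, (simplexMap x a).2 + 1) : Y × ℝ) =
      ((simplexMap y a).1, (simplexMap y a).2 + 1) := congrArg (fun s => simplexMap s a) hxy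
    exact Prod.ext (Prod.mk.inj h).1 (add_right_cancel (Prod.mk.inj h).2)
  · intro n k x hx
    obtain ⟨a⟩ : Nonempty (SimplexCategory.toTop.{0}.obj ⦋n⦌) := inferInstance
    have h := toSSet_map_deckShift_iterate Y n k x a
    rw [hx] at h
    have h2 : (simplexMap x a).2 = (simplexMap x a).2 + k := (Prod.mk.inj ((Prod.mk.eta).trans h)).2
    exact_mod_cast (left_eq_add.1 h2)
  · intro n y
    obtain ⟨s, hs⟩ := exists_lift_circle
      (⟨fun a => (simplexMap y a).2,
        continuous_snd.comp (simplexMap y).continuous⟩ :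
        C(SimplexCategory.toTop.{0}.obj ⦋n⦌, UnitAddCircle))
    refine ⟨⟨TopCat.ofHom ⟨fun a => ((simplexMap y a).1, s a),
      (continuous_fst.comp (simplexMap y).continuous).prodMk s.continuous⟩⟩, ?_⟩
    exact simplex_ext fun a => Prod.ext rfl (hs a)
  · intro n x y hxy
    have h : ∀ a, (((simplexMap x a).1, ((simplexMap x a).2 : UnitAddCircle)) :
        Y × UnitAddCircle) = ((simplexMap y a).1, ((simplexMap y a).2 : UnitAddCircle)) :=
      fun a => congrArg (fun s => simplexMap s a) hxy
    obtain ⟨k, hk⟩ := exists_int_const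
      (A := SimplexCategory.toTop.{0}.obj ⦋n⦌)
      (f := fun a => (simplexMap y a).2 - (simplexMap x a).2)
      ((continuous_snd.comp (simplexMap y).continuous).sub
        (continuous_snd.comp (simplexMap x).continuous))
      (fun a => exists_int_of_coe_eq (Prod.mk.inj (h a)).2)
    have h1 : ∀ a, (simplexMap x a).1 = (simplexMap y a).1 := fun a => (Prod.mk.inj (h a)).1
    -- Only forward iterates are available, so the sign of `k` decides which simplex is an iterate
    -- of the other.
    obtain ⟨m, rfl | rfl⟩ := k.eq_nat_or_neg
    · refine ⟨m, Or.inl (simplex_ext fun a => ?_)⟩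
      refine Eq.trans ?_ (toSSet_map_deckShift_iterate Y n m x a).symm
      have := hk a
      push_cast at this
      exact Prod.ext (h1 a).symm (by linarith)
    · refine ⟨m, Or.inr (simplex_ext fun a => ?_)⟩
      refine Eq.trans ?_ (toSSet_map_deckShift_iterate Y n m y a).symm
      have := hk a
      push_cast at this
      exact Prod.ext (h1 a) (by linarith)

theorem homologyMap_coverSequence_f (n : ℕ) :
    HomologicalComplex.homologyMap (coverSequence Y).f n = 0 := by
  refine (HomologicalComplex.homologyMap_sub (ratChainMap (deckShift Y)) (𝟙 _) n).trans ?_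
  rw [HomologicalComplex.homologyMap_id]
  exact sub_eq_zero.2 <| (ratHomologyMap_congr n (deckShift_homotopic Y)).trans (CategoryTheory.Functor.map_id _ _)

end Covering

/-! ### Lefschetz numbers of torus maps that lift to the cylinder -/

section Lefschetz

/-- `S¹ × ℝ` has the rational homology of a circle. -/
theorem finrank_ratHomology_cylinder (n : ℕ) :
    FiniteDimensional ℚ (ratHomology n (TopCat.of (UnitAddCircle × ℝ))) ∧
    Module.finrank ℚ (ratHomology n (TopCat.of (UnitAddCircle × ℝ))) = if n ≤ 1 then 1 else 0 := by
  let e : ratHomology n (TopCat.of (UnitAddCircle × ℝ)) ≃ₗ[ℚ]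
      ratHomology n (TopCat.of (ℝ × UnitAddCircle)) :=
    (((AlgebraicTopology.singularHomologyFunctor (ModuleCat.{0} ℚ) n).obj
      (ModuleCat.of ℚ ℚ)).mapIso (TopCat.isoOfHomeo
        (X := TopCat.of (UnitAddCircle × ℝ)) (Y := TopCat.of (ℝ × UnitAddCircle))
        (Homeomorph.prodComm _ _))).toLinearEquiv
  suffices FiniteDimensional ℚ (ratHomology n (TopCat.of (ℝ × UnitAddCircle))) ∧
      Module.finrank ℚ (ratHomology n (TopCat.of (ℝ × UnitAddCircle))) =
        if n ≤ 1 then 1 else 0 by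
    obtain ⟨h1, h2⟩ := this
    exact ⟨Module.Finite.equiv e.symm, by rw [e.finrank_eq, h2]⟩
  have : ContractibleSpace (TopCat.of (ℝ × ℝ)) := inferInstanceAs (ContractibleSpace (ℝ × ℝ))
  have : PathConnectedSpace (TopCat.of (ℝ × UnitAddCircle)) :=
    inferInstanceAs (PathConnectedSpace (ℝ × UnitAddCircle))
  have hzero : ∀ m, FiniteDimensional ℚ (ratHomology (m + 1) (TopCat.of (ℝ × ℝ))) ∧
      Module.finrank ℚ (ratHomology (m + 1) (TopCat.of (ℝ × ℝ))) = 0 := by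
    intro m
    have := ModuleCat.isZero_iff_subsingleton.1
      (isZero_ratHomology_of_contractible m (TopCat.of (ℝ × ℝ)))
    exact ⟨inferInstance, Module.finrank_zero_of_subsingleton⟩
  have hall : ∀ m, FiniteDimensional ℚ (ratHomology m (TopCat.of (ℝ × ℝ))) ∧
      Module.finrank ℚ (ratHomology m (TopCat.of (ℝ × ℝ))) = if m = 0 then 1 else 0 := by
    rintro (_ | m)
    · exact finrank_ratHomology_zero _
    · simpa using hzero m
  rcases n with _ | n
  · simpa using finrank_ratHomology_zero (TopCat.of (ℝ × UnitAddCircle))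
  · have : FiniteDimensional ℚ ((coverSequence ℝ).X₂.homology (n + 1)) := (hall (n + 1)).1
    have : FiniteDimensional ℚ ((coverSequence ℝ).X₁.homology n) := (hall n).1
    obtain ⟨h1, h2⟩ := trace_homologyMap_succ (coverSequence_shortExact ℝ)
      (homologyMap_coverSequence_f ℝ) n
    refine ⟨h1, ?_⟩
    -- For the identity, the trace formula is an identity between dimensions.
    have h3 := h2 (𝟙 _)
    rw [ShortComplex.id_τ₁, ShortComplex.id_τ₂, ShortComplex.id_τ₃,
      HomologicalComplex.homologyMap_id, HomologicalComplex.homologyMap_id,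
      HomologicalComplex.homologyMap_id, ModuleCat.hom_id, ModuleCat.hom_id, ModuleCat.hom_id,
      LinearMap.trace_id, LinearMap.trace_id, LinearMap.trace_id] at h3
    have h4 : Module.finrank ℚ (ratHomology (n + 1) (TopCat.of (ℝ × UnitAddCircle))) =
        Module.finrank ℚ (ratHomology (n + 1) (TopCat.of (ℝ × ℝ))) +
        Module.finrank ℚ (ratHomology n (TopCat.of (ℝ × ℝ))) := by exact_mod_cast h3
    rw [h4, (hall (n + 1)).2, (hall n).2]
    rcases n with _ | n <;> simp

/-- The two cases of `hd` are `d = 1` and `d = -1`. `F` acts as the identity on the homology of the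
cylinder, while the endomorphism `φ₁` of the first term of the sequence acts with trace `d` times
the dimension. -/
theorem lefschetzNumber_eq_zero_of_cover
    (F : TopCat.of (UnitAddCircle × ℝ) ⟶ TopCat.of (UnitAddCircle × ℝ)) (f : C(Torus, Torus))
    (hF : (TopCat.Hom.hom F).Homotopic (TopCat.Hom.hom (𝟙 (TopCat.of (UnitAddCircle × ℝ)))))
    (hFf : F ≫ circleCover UnitAddCircle = circleCover UnitAddCircle ≫ TopCat.ofHom f)
    (hd : deckShift UnitAddCircle ≫ F = F ≫ deckShift UnitAddCircle ∨
      deckShift UnitAddCircle ≫ F ≫ deckShift UnitAddCircle = F) :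
    lefschetzNumber f = 0 := by
  have hFn : ∀ n, HomologicalComplex.homologyMap (ratChainMap F) n = 𝟙 _ := fun n =>
    (ratHomologyMap_congr n hF).trans (CategoryTheory.Functor.map_id _ _)
  have hfin : ∀ n, FiniteDimensional ℚ (ratHomology n (TopCat.of (UnitAddCircle × ℝ))) :=
    fun n => (finrank_ratHomology_cylinder n).1
  have htrid : ∀ n, LinearMap.trace ℚ (ratHomology n (TopCat.of (UnitAddCircle × ℝ)))
      LinearMap.id = Module.finrank ℚ (ratHomology n (TopCat.of (UnitAddCircle × ℝ))) :=
    fun n => LinearMap.trace_id _ _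
  have htrF : ∀ n, LinearMap.trace ℚ _ (HomologicalComplex.homologyMap (ratChainMap F) n).hom =
      Module.finrank ℚ (ratHomology n (TopCat.of (UnitAddCircle × ℝ))) := fun n => by
    rw [hFn]
    exact htrid n
  have hcomm : ratChainMap F ≫ ratChainMap (circleCover UnitAddCircle) =
      ratChainMap (circleCover UnitAddCircle) ≫ ratChainMap (TopCat.ofHom f) := by
    rw [← ratChainMap_comp, hFf, ratChainMap_comp]
  obtain ⟨d, φ₁, hφ, hφn⟩ : ∃ d : ℚ,
      ∃ φ₁ : (coverSequence UnitAddCircle).X₁ ⟶ (coverSequence UnitAddCircle).X₁,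
      φ₁ ≫ (coverSequence UnitAddCircle).f = (coverSequence UnitAddCircle).f ≫ ratChainMap F ∧
      ∀ n, LinearMap.trace ℚ _ (HomologicalComplex.homologyMap φ₁ n).hom =
        d * Module.finrank ℚ (ratHomology n (TopCat.of (UnitAddCircle × ℝ))) := by
    rcases hd with hd | hd
    · refine ⟨1, ratChainMap F, ?_, fun n => ?_⟩
      · have h : ratChainMap F ≫ (ratChainMap (deckShift UnitAddCircle) - 𝟙 _) =
            (ratChainMap (deckShift UnitAddCircle) - 𝟙 _) ≫ ratChainMap F := by
          rw [Preadditive.comp_sub, Preadditive.sub_comp, Category.comp_id, Category.id_comp,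
            ← ratChainMap_comp, ← ratChainMap_comp, hd]
        exact h
      · rw [one_mul]
        exact htrF n
    -- From `T F T = F` one gets `-(T F)(T - 1) = (T - 1) F`.
    · refine ⟨-1, -(ratChainMap (deckShift UnitAddCircle ≫ F)), ?_, fun n => ?_⟩
      · have h : (-ratChainMap (deckShift UnitAddCircle ≫ F)) ≫
            (ratChainMap (deckShift UnitAddCircle) - 𝟙 _) =
            (ratChainMap (deckShift UnitAddCircle) - 𝟙 _) ≫ ratChainMap F := by
          rw [Preadditive.comp_sub, Preadditive.sub_comp, Category.comp_id, Category.id_comp,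
            Preadditive.neg_comp, ← ratChainMap_comp, ← ratChainMap_comp, Category.assoc, hd,
            sub_neg_eq_add, neg_add_eq_sub]
        exact h
      · have htF : HomologicalComplex.homologyMap
            (ratChainMap (deckShift UnitAddCircle ≫ F)) n = 𝟙 _ := by
          rw [ratChainMap_comp, HomologicalComplex.homologyMap_comp, hFn, Category.comp_id]
          exact (ratHomologyMap_congr n (deckShift_homotopic _)).trans
            (CategoryTheory.Functor.map_id _ _)
        have h : LinearMap.trace ℚ _ (HomologicalComplex.homologyMap
            (-ratChainMap (deckShift UnitAddCircle ≫ F)) n).hom =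
            -1 * Module.finrank ℚ (ratHomology n (TopCat.of (UnitAddCircle × ℝ))) := by
          rw [HomologicalComplex.homologyMap_neg, htF, ModuleCat.hom_neg, map_neg, neg_one_mul]
          exact congrArg _ (htrid n)
        exact h
  let φ : coverSequence UnitAddCircle ⟶ coverSequence UnitAddCircle :=
    { τ₁ := φ₁
      τ₂ := ratChainMap F
      τ₃ := ratChainMap (TopCat.ofHom f)
      comm₁₂ := hφ
      comm₂₃ := hcomm }
  have hsucc : ∀ n, LinearMap.trace ℚ _ (ratHomologyMap (n + 1) (TopCat.ofHom f)).hom =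
      Module.finrank ℚ (ratHomology (n + 1) (TopCat.of (UnitAddCircle × ℝ))) + d * Module.finrank ℚ (ratHomology n (TopCat.of (UnitAddCircle × ℝ))) := by
    intro n
    have : FiniteDimensional ℚ ((coverSequence UnitAddCircle).X₂.homology (n + 1)) := hfin (n + 1)
    have : FiniteDimensional ℚ ((coverSequence UnitAddCircle).X₁.homology n) := hfin n
    have h := (trace_homologyMap_succ (coverSequence_shortExact UnitAddCircle)
      (homologyMap_coverSequence_f UnitAddCircle) n).2 φ
    rw [← hφn n]
    exact h.trans (congrArg (· + _) (htrF (n + 1)))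
  have h0 : LinearMap.trace ℚ _ (ratHomologyMap 0 (TopCat.ofHom f)).hom =
      Module.finrank ℚ (ratHomology 0 (TopCat.of (UnitAddCircle × ℝ))) := by
    have h := trace_homologyMap_zero (coverSequence_shortExact UnitAddCircle)
      (homologyMap_coverSequence_f UnitAddCircle 0) φ
    exact h.trans (htrF 0)
  have hsum : lefschetzNumber f =
      LinearMap.trace ℚ _ (ratHomologyMap 0 (TopCat.ofHom f)).hom
      - LinearMap.trace ℚ _ (ratHomologyMap 1 (TopCat.ofHom f)).hom
      + LinearMap.trace ℚ _ (ratHomologyMap 2 (TopCat.ofHom f)).hom := by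
    rw [lefschetzNumber, Finset.sum_range_succ, Finset.sum_range_succ, Finset.sum_range_one]
    ring
  -- The cylinder has Betti numbers `1, 1, 0`, so the sum is `1 - (1 + d) + (0 + d)`.
  rw [hsum, h0, hsucc 0, hsucc 1, (finrank_ratHomology_cylinder _).2,
    (finrank_ratHomology_cylinder _).2, (finrank_ratHomology_cylinder _).2]
  norm_num

end Lefschetz

end NilpotentTorus

namespace NilpotentTorus

open MeasureTheory CategoryTheory

/-! ### Lifts to the plane and their action on the lattice -/

section Lifts

/-- The lattice vectors in the plane. -/
def intVec (v : ℤ × ℤ) : Plane := ((v.1 : ℝ), (v.2 : ℝ))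

theorem intVec_add (v w : ℤ × ℤ) : intVec (v + w) = intVec v + intVec w := by
  simp [intVec]

theorem intVec_zero : intVec 0 = 0 := by simp [intVec]

theorem intVec_injective : Function.Injective intVec := by
  intro v w h
  have h' := Prod.mk.inj h
  exact Prod.ext (by exact_mod_cast h'.1) (by exact_mod_cast h'.2)

theorem proj_add_intVec (x : Plane) (v : ℤ × ℤ) : proj (x + intVec v) = proj x := by
  refine Prod.ext ?_ ?_
  · change ((x.1 + v.1 : ℝ) : UnitAddCircle) = _
    rw [AddCircle.coe_add, coe_int_circle, add_zero]; rfl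
  · change ((x.2 + v.2 : ℝ) : UnitAddCircle) = _
    rw [AddCircle.coe_add, coe_int_circle, add_zero]; rfl

theorem exists_intVec_of_proj_eq {x y : Plane} (h : proj x = proj y) :
    ∃ v, y = x + intVec v := by
  obtain ⟨k, hk⟩ := exists_int_of_coe_eq (congrArg Prod.fst h)
  obtain ⟨l, hl⟩ := exists_int_of_coe_eq (congrArg Prod.snd h)
  refine ⟨(k, l), Prod.ext ?_ ?_⟩
  · change y.1 = x.1 + k; linarith
  · change y.2 = x.2 + l; linarith

theorem proj_surjective : Function.Surjective proj := fun z => ⟨_, proj_fundamentalSection z⟩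

theorem isOpenQuotientMap_coe_circle : IsOpenQuotientMap ((↑) : ℝ → UnitAddCircle) :=
  QuotientAddGroup.isOpenQuotientMap_mk

theorem isOpenQuotientMap_proj : IsOpenQuotientMap proj :=
  isOpenQuotientMap_coe_circle.prodMap isOpenQuotientMap_coe_circle

/-- Two lifts of the same map on a connected space differ by a lattice vector. -/
theorem exists_intVec_const {A : Type*} [TopologicalSpace A] [PreconnectedSpace A]
    {f g : A → Plane} (hf : Continuous f) (hg : Continuous g) (h : ∀ a, proj (f a) = proj (g a)) :
    ∃ v, ∀ a, g a = f a + intVec v := by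
  choose w hw using fun a => exists_intVec_of_proj_eq (h a)
  obtain ⟨k, hk⟩ := exists_int_const (f := fun a => (g a).1 - (f a).1) (by fun_prop)
    (fun a => ⟨(w a).1, by rw [hw a]; simp [intVec]⟩)
  obtain ⟨l, hl⟩ := exists_int_const (f := fun a => (g a).2 - (f a).2) (by fun_prop)
    (fun a => ⟨(w a).2, by rw [hw a]; simp [intVec]⟩)
  refine ⟨(k, l), fun a => Prod.ext ?_ ?_⟩
  · change (g a).1 = (f a).1 + k; linarith [hk a]
  · change (g a).2 = (f a).2 + l; linarith [hl a]

theorem IsLift.mul {F F' : Plane ≃ₜ Plane} {f f' : Torus ≃ₜ Torus} (h : IsLift F f)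
    (h' : IsLift F' f') : IsLift (F * F') (f * f') := fun x => by
  change proj (F (F' x)) = f (f' (proj x))
  rw [h, h']

theorem IsLift.inv {F : Plane ≃ₜ Plane} {f : Torus ≃ₜ Torus} (h : IsLift F f) :
    IsLift F⁻¹ f⁻¹ := fun x => by
  change proj (F.symm x) = f.symm (proj x)
  rw [Homeomorph.eq_symm_apply, ← h, F.apply_symm_apply]

theorem IsLift.one : IsLift 1 1 := fun _ => rfl

theorem IsLift.unique {F : Plane ≃ₜ Plane} {f f' : Torus ≃ₜ Torus} (h : IsLift F f)
    (h' : IsLift F f') : f = f' := by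
  ext1 z
  obtain ⟨x, rfl⟩ := proj_surjective z
  rw [← h, h']

theorem IsLift.exists_add {F F' : Plane ≃ₜ Plane} {f : Torus ≃ₜ Torus} (h : IsLift F f)
    (h' : IsLift F' f) : ∃ v, ∀ x, F' x = F x + intVec v :=
  exists_intVec_const F.continuous F'.continuous fun x => (h x).trans (h' x).symm

/-- A lift of a homeomorphism acts on the lattice by an integer matrix. -/
theorem IsLift.exists_matrix {F : Plane ≃ₜ Plane} {f : Torus ≃ₜ Torus} (h : IsLift F f) :
    ∃ a b c d : ℤ, ∀ x (v : ℤ × ℤ),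
      F (x + intVec v) = F x + intVec (a * v.1 + b * v.2, c * v.1 + d * v.2) := by
  have key : ∀ v, ∃ w, ∀ x, F (x + intVec v) = F x + intVec w := fun v =>
    exists_intVec_const F.continuous (by fun_prop) fun x => by
      rw [h, h, proj_add_intVec]
  choose A hA using key
  let B : ℤ × ℤ →+ ℤ × ℤ :=
    { toFun := A
      map_zero' := by
        have := hA 0 0
        rw [intVec_zero, add_zero, left_eq_add, ← intVec_zero] at this
        exact intVec_injective this
      map_add' := fun v w => by
        have h1 := hA (v + w) 0
        rw [intVec_add, ← add_assoc, hA, hA, add_assoc, add_right_inj, ← intVec_add] at h1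
        rw [← intVec_injective h1, add_comm] }
  refine ⟨(A (1, 0)).1, (A (0, 1)).1, (A (1, 0)).2, (A (0, 1)).2, fun x v => ?_⟩
  have hv : v = v.1 • (1, 0) + v.2 • (0, 1) := by ext <;> simp
  have hB : A v = v.1 • A (1, 0) + v.2 • A (0, 1) := by
    change B v = v.1 • B (1, 0) + v.2 • B (0, 1)
    rw [← map_zsmul, ← map_zsmul, ← map_add, ← hv]
  rw [hA, hB]
  congr 2
  ext <;> simp [mul_comm]

theorem exists_lift_plane {A : Type*} [TopologicalSpace A] [ContractibleSpace A]
    {σ : A → Torus} (hσ : Continuous σ) : ∃ s : A → Plane, Continuous s ∧ ∀ a, proj (s a) = σ a := by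
  obtain ⟨s, hs⟩ := exists_lift_circle ⟨fun a => (σ a).1, by fun_prop⟩
  obtain ⟨t, ht⟩ := exists_lift_circle ⟨fun a => (σ a).2, by fun_prop⟩
  exact ⟨fun a => (s a, t a), by fun_prop, fun a => Prod.ext (hs a) (ht a)⟩

/-- A continuous map of the plane that covers a homeomorphism of the torus is a homeomorphism. -/
theorem exists_homeomorph_of_covers {g : Plane → Plane} (hg : Continuous g) (f : Torus ≃ₜ Torus)
    (h : ∀ x, proj (g x) = f (proj x)) : ∃ F : Plane ≃ₜ Plane, ∀ x, F x = g x := by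
  -- A lift `s` of `f⁻¹ ∘ π` inverts `g` up to a translation on either side.
  obtain ⟨s, hs, hsp⟩ := exists_lift_plane (A := Plane) (σ := fun x => f.symm (proj x))
    (f.symm.continuous.comp isOpenQuotientMap_proj.continuous)
  obtain ⟨v, hv⟩ := exists_intVec_const (A := Plane) (f := fun x => x) (g := fun x => s (g x))
    continuous_id (hs.comp hg) fun x => by rw [hsp, h, f.symm_apply_apply]
  obtain ⟨w, hw⟩ := exists_intVec_const (A := Plane) (f := fun x => x) (g := fun x => g (s x))
    continuous_id (hg.comp hs) fun x => by rw [h, hsp, f.apply_symm_apply]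
  have hleft : ∀ x, s (g x) - intVec v = x := fun x => by rw [hv, add_sub_cancel_right]
  have hright : ∀ x, g (s x - intVec v) = x := fun x => by
    have hx : x = g (s (x - intVec w)) := by rw [hw, sub_add_cancel]
    rw [hx, hleft]
  exact ⟨⟨⟨g, fun x => s x - intVec v, hleft, hright⟩, hg, hs.sub continuous_const⟩, fun _ => rfl⟩

end Lifts

/-! ### Lifting isotopies -/

section Isotopy

/-- The homotopy lifts coordinatewise from the identity; each stage covers a homeomorphism, hence is
one. -/
theorem exists_lift_isotopy {γ : unitInterval → (Torus ≃ₜ Torus)}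
    (hγ : Continuous (fun p : unitInterval × Torus => γ p.1 p.2)) (h0 : γ 0 = 1) :
    ∃ Γ : unitInterval → (Plane ≃ₜ Plane),
      Continuous (fun p : unitInterval × Plane => Γ p.1 p.2) ∧ Γ 0 = 1 ∧
      ∀ t, IsLift (Γ t) (γ t) := by
  have cov := AddCircle.isCoveringMap_coe (1 : ℝ)
  have hc : Continuous fun p : unitInterval × Plane => γ p.1 (proj p.2) :=
    hγ.comp (continuous_fst.prodMk (isOpenQuotientMap_proj.continuous.comp continuous_snd))
  let H₁ : C(unitInterval × Plane, UnitAddCircle) := ⟨fun p => (γ p.1 (proj p.2)).1, hc.fst⟩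
  let H₂ : C(unitInterval × Plane, UnitAddCircle) := ⟨fun p => (γ p.1 (proj p.2)).2, hc.snd⟩
  let f₁ : C(Plane, ℝ) := ⟨Prod.fst, continuous_fst⟩
  let f₂ : C(Plane, ℝ) := ⟨Prod.snd, continuous_snd⟩
  have e₁ : ∀ x, H₁ (0, x) = ((f₁ x : ℝ) : UnitAddCircle) := fun x => by
    change (γ 0 (proj x)).1 = _
    rw [h0]; rfl
  have e₂ : ∀ x, H₂ (0, x) = ((f₂ x : ℝ) : UnitAddCircle) := fun x => by
    change (γ 0 (proj x)).2 = _
    rw [h0]; rfl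
  let g : unitInterval × Plane → Plane := fun p =>
    (cov.liftHomotopy H₁ f₁ e₁ p, cov.liftHomotopy H₂ f₂ e₂ p)
  have hg : Continuous g := by fun_prop
  have hgp : ∀ p, proj (g p) = γ p.1 (proj p.2) := fun p => Prod.ext
    (congrFun (cov.liftHomotopy_lifts H₁ f₁ e₁) p) (congrFun (cov.liftHomotopy_lifts H₂ f₂ e₂) p)
  have hg0 : ∀ x, g (0, x) = x := fun x => Prod.ext
    (cov.liftHomotopy_zero H₁ f₁ e₁ x) (cov.liftHomotopy_zero H₂ f₂ e₂ x)
  choose Γ hΓ using fun t => exists_homeomorph_of_covers (g := fun x => g (t, x))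
    (by fun_prop) (γ t) fun x => hgp (t, x)
  refine ⟨Γ, hg.congr fun p => (hΓ p.1 p.2).symm, ?_, fun t x => ?_⟩
  · ext1 x
    rw [hΓ, hg0]; rfl
  · rw [hΓ, hgp]

/-- Lifts of homeomorphisms isotopic to the identity commute with the lattice translations. -/
theorem IsLift.map_add_intVec {F : Plane ≃ₜ Plane} {f : Torus ≃ₜ Torus} (h : IsLift F f)
    (hf : IsotopicToId f) (x : Plane) (v : ℤ × ℤ) : F (x + intVec v) = F x + intVec v := by
  obtain ⟨γ, hγ, h0, h1⟩ := hf
  obtain ⟨Γ, hΓ, hΓ0, hlift⟩ := exists_lift_isotopy hγ h0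
  -- The lattice vector `Γ t (x + v) - Γ t x` is constant in both `t` and `x`, and at `t = 0` it is
  -- `v`.
  obtain ⟨w, hw⟩ := exists_intVec_const (A := unitInterval × Plane)
    (f := fun p => Γ p.1 p.2) (g := fun p => Γ p.1 (p.2 + intVec v)) hΓ
    (hΓ.comp (continuous_fst.prodMk (continuous_snd.add continuous_const)))
    (fun p => by rw [hlift, hlift, proj_add_intVec])
  have hwv : intVec w = intVec v := by
    have := hw (0, 0)
    rw [hΓ0] at this
    simpa using this.symm
  obtain ⟨u, hu⟩ := (h1 ▸ hlift 1 : IsLift (Γ 1) f).exists_add h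
  rw [hu, hu, hw (1, x), hwv, add_right_comm]

/-- The lifted isotopy ends at `F` up to a lattice vector `u`; adding `t • u` at time `t` corrects
this. -/
theorem IsLift.isotopicToId {F : Plane ≃ₜ Plane} {f : Torus ≃ₜ Torus} (h : IsLift F f)
    (hf : IsotopicToId f) : IsotopicToId F := by
  obtain ⟨γ, hγ, h0, h1⟩ := hf
  obtain ⟨Γ, hΓ, hΓ0, hlift⟩ := exists_lift_isotopy hγ h0
  obtain ⟨u, hu⟩ := (h1 ▸ hlift 1 : IsLift (Γ 1) f).exists_add h
  refine ⟨fun t => (Γ t).trans (Homeomorph.addRight ((t : ℝ) • intVec u)), ?_, ?_, ?_⟩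
  · change Continuous fun p : unitInterval × Plane => Γ p.1 p.2 + ((p.1 : ℝ) • intVec u)
    exact hΓ.add ((continuous_subtype_val.comp continuous_fst).smul continuous_const)
  · ext1 x
    change Γ 0 x + ((0 : unitInterval) : ℝ) • intVec u = x
    rw [hΓ0]; simp
  · ext1 x
    change Γ 1 x + ((1 : unitInterval) : ℝ) • intVec u = F x
    rw [hu]; simp

end Isotopy

/-! ### Lefschetz number and the matrix of a lift -/

section LefschetzLift

theorem lefschetzNumber_conj (P f : Torus ≃ₜ Torus) :
    lefschetzNumber ((P * f * P⁻¹ : Torus ≃ₜ Torus) : C(Torus, Torus)) =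
      lefschetzNumber (f : C(Torus, Torus)) := by
  refine Finset.sum_congr rfl fun n _ => congrArg _ ?_
  let e : ratHomology n (TopCat.of Torus) ≃ₗ[ℚ] ratHomology n (TopCat.of Torus) :=
    (((AlgebraicTopology.singularHomologyFunctor (ModuleCat.{0} ℚ) n).obj
      (ModuleCat.of ℚ ℚ)).mapIso (TopCat.isoOfHomeo
        (X := TopCat.of Torus) (Y := TopCat.of Torus) P)).toLinearEquiv
  rw [← LinearMap.trace_conj' (ratHomologyMap n (TopCat.ofHom (f : C(Torus, Torus)))).hom e]
  congr 1
  have h : TopCat.ofHom ((P * f * P⁻¹ : Torus ≃ₜ Torus) : C(Torus, Torus)) =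
      (TopCat.isoOfHomeo (X := TopCat.of Torus) (Y := TopCat.of Torus) P).inv ≫
        TopCat.ofHom (f : C(Torus, Torus)) ≫
        (TopCat.isoOfHomeo (X := TopCat.of Torus) (Y := TopCat.of Torus) P).hom := rfl
  rw [h, Functor.map_comp, Functor.map_comp]
  rfl

/-- If a lift commutes with the first unit translation, the Lefschetz number vanishes. -/
theorem lefschetzNumber_eq_zero_of_commutes {F : Plane ≃ₜ Plane} {f : Torus ≃ₜ Torus}
    (h : IsLift F f) (h1 : ∀ x, F (x + intVec (1, 0)) = F x + intVec (1, 0)) :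
    lefschetzNumber (f : C(Torus, Torus)) = 0 := by
  obtain ⟨a, b, c, d, hA⟩ := h.exists_matrix
  obtain ⟨a', b', c', d', hA'⟩ := h.inv.exists_matrix
  obtain ⟨rfl, rfl⟩ : a = 1 ∧ c = 0 := by
    have := hA 0 (1, 0)
    rw [h1, add_right_inj] at this
    have := intVec_injective this
    simpa [eq_comm] using this
  -- The matrix is `(1, b; 0, d)`; comparing with the inverse lift shows that `d` is a unit.
  have hdd : d * d' = 1 := by
    have h2 := hA' 0 (0, 1)
    simp only [mul_zero, mul_one, zero_add] at h2
    have h3 := congrArg F h2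
    have hFF : ∀ y, F (F⁻¹ y) = y := F.apply_symm_apply
    rw [hA, hFF, hFF, zero_add] at h3
    have := congrArg Prod.snd (intVec_injective h3)
    simpa using this.symm
  have hs : Function.Surjective ((↑) : ℝ → UnitAddCircle) := QuotientAddGroup.mk_surjective
  -- `F - Id` descends to the cylinder because `F` commutes with the first translation; `hD` shows
  -- that the representative is immaterial.
  let D : UnitAddCircle × ℝ → Plane := fun z =>
    F (Function.surjInv hs z.1, z.2) - (Function.surjInv hs z.1, z.2)
  have hD : ∀ x y : ℝ, D (x, y) = F (x, y) - (x, y) := by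
    intro x y
    obtain ⟨k, hk⟩ := exists_int_of_coe_eq (Function.surjInv_eq hs (x : UnitAddCircle)).symm
    have hx : ((Function.surjInv hs (x : UnitAddCircle), y) : Plane) =
        (x, y) + intVec (k, 0) := by
      refine Prod.ext ?_ ?_
      · change _ = x + (k : ℝ); linarith
      · simp [intVec]
    change F (_, y) - (_, y) = _
    rw [hx, hA]
    simp
  have hDc : Continuous D := by
    have hq : IsOpenQuotientMap (Prod.map ((↑) : ℝ → UnitAddCircle) (id : ℝ → ℝ)) :=
      isOpenQuotientMap_coe_circle.prodMap IsOpenQuotientMap.id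
    rw [hq.isQuotientMap.continuous_iff]
    exact (F.continuous.sub continuous_id).congr fun z => (hD z.1 z.2).symm
  have hcoe : Continuous ((↑) : ℝ → UnitAddCircle) := AddCircle.continuous_mk' 1
  have hDs : ∀ z r, D (z, r + 1) = D (z, r) + intVec (b, d - 1) := by
    intro z r
    obtain ⟨x, rfl⟩ := hs z
    have hx : ((x, r + 1) : Plane) = (x, r) + intVec (0, 1) := by simp [intVec]
    rw [hD, hD, hx, hA]
    ext <;> simp [intVec] <;> ring
  let E : C(UnitAddCircle × ℝ, UnitAddCircle × ℝ) :=
    ⟨fun z => (z.1 + ((D z).1 : UnitAddCircle), z.2 + (D z).2), by fun_prop⟩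
  have hE : ∀ z r, E (z, r + 1) = ((E (z, r)).1, (E (z, r)).2 + d) := by
    intro z r
    refine Prod.ext ?_ ?_
    · change z + ((D (z, r + 1)).1 : UnitAddCircle) = z + ((D (z, r)).1 : UnitAddCircle)
      rw [hDs]
      change z + (((D (z, r)).1 + (b : ℝ) : ℝ) : UnitAddCircle) = _
      rw [AddCircle.coe_add, coe_int_circle, add_zero]
    · change r + 1 + (D (z, r + 1)).2 = r + (D (z, r)).2 + d
      rw [hDs]
      change r + 1 + ((D (z, r)).2 + ((d - 1 : ℤ) : ℝ)) = _
      push_cast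
      ring
  refine lefschetzNumber_eq_zero_of_cover (TopCat.ofHom E) _ ⟨?_⟩ ?_ ?_
  · exact
      -- The displacement `D` takes values in the plane, so it can be scaled down to zero.
      { toFun := fun p => (p.2.1 + (((1 - (p.1 : ℝ)) * (D p.2).1 : ℝ) : UnitAddCircle),
          p.2.2 + (1 - (p.1 : ℝ)) * (D p.2).2)
        continuous_toFun := by fun_prop
        map_zero_left := fun z => by
          simp only [Set.Icc.coe_zero, sub_zero, one_mul]
          rfl
        map_one_left := fun z => by
          simp only [Set.Icc.coe_one, sub_self, zero_mul, add_zero, AddCircle.coe_zero]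
          rfl }
  · refine TopCat.hom_ext (ContinuousMap.ext fun z => ?_)
    obtain ⟨z, r⟩ := z
    obtain ⟨x, rfl⟩ := hs z
    have : proj (F (x, r)) = f (proj (x, r)) := h (x, r)
    refine Eq.trans ?_ this
    refine Prod.ext ?_ ?_
    · change (x : UnitAddCircle) + ((D (x, r)).1 : UnitAddCircle) = ((F (x, r)).1 : UnitAddCircle)
      rw [hD, ← AddCircle.coe_add]
      simp
    · change ((r + (D (x, r)).2 : ℝ) : UnitAddCircle) = ((F (x, r)).2 : UnitAddCircle)
      rw [hD]
      simp
  · rcases Int.isUnit_iff.1 (IsUnit.of_mul_eq_one d' hdd) with rfl | rfl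
    · refine Or.inl (TopCat.hom_ext (ContinuousMap.ext fun z => ?_))
      exact (hE z.1 z.2).trans (Prod.ext rfl (by simp [deckShift]))
    · refine Or.inr (TopCat.hom_ext (ContinuousMap.ext fun z => ?_))
      change ((E (z.1, z.2 + 1)).1, (E (z.1, z.2 + 1)).2 + 1) = E z
      rw [hE]
      simp

/-- The automorphism of `M × M` given by an integer matrix of determinant one. -/
def unimodularHomeo (M : Type*) [AddCommGroup M] [TopologicalSpace M] [IsTopologicalAddGroup M]
    (u w p q : ℤ) (h : u * p + w * q = 1) : M × M ≃ₜ M × M where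
  toFun x := (u • x.1 + w • x.2, p • x.2 - q • x.1)
  invFun x := (p • x.1 - w • x.2, q • x.1 + u • x.2)
  left_inv x := by
    have h' : ∀ y : M, y = (u * p + w * q) • y := fun y => by rw [h, one_smul]
    refine Prod.ext ?_ ?_
    · refine Eq.trans ?_ (h' x.1).symm
      dsimp only
      module
    · refine Eq.trans ?_ (h' x.2).symm
      dsimp only
      module
  right_inv x := by
    have h' : ∀ y : M, y = (u * p + w * q) • y := fun y => by rw [h, one_smul]
    refine Prod.ext ?_ ?_
    · refine Eq.trans ?_ (h' x.1).symm
      dsimp only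
      module
    · refine Eq.trans ?_ (h' x.2).symm
      dsimp only
      module
  continuous_toFun := by fun_prop
  continuous_invFun := by fun_prop

theorem isLift_unimodularHomeo (u w p q : ℤ) (h : u * p + w * q = 1) :
    IsLift (unimodularHomeo ℝ u w p q h) (unimodularHomeo UnitAddCircle u w p q h) := fun x => by
  refine Prod.ext ?_ ?_
  · change ((u • x.1 + w • x.2 : ℝ) : UnitAddCircle) = u • (x.1 : UnitAddCircle) + w • x.2
    rw [AddCircle.coe_add, AddCircle.coe_zsmul, AddCircle.coe_zsmul]
  · change ((p • x.2 - q • x.1 : ℝ) : UnitAddCircle) = p • (x.2 : UnitAddCircle) - q • x.1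
    rw [AddCircle.coe_sub, AddCircle.coe_zsmul, AddCircle.coe_zsmul]

/-- If the Lefschetz number is nonzero, the matrix of a lift does not have the eigenvalue one. -/
theorem det_ne_zero_of_lefschetzNumber_ne_zero {F : Plane ≃ₜ Plane} {f : Torus ≃ₜ Torus}
    (h : IsLift F f) (hL : lefschetzNumber (f : C(Torus, Torus)) ≠ 0) {a b c d : ℤ}
    (hA : ∀ x (v : ℤ × ℤ), F (x + intVec v) = F x + intVec (a * v.1 + b * v.2, c * v.1 + d * v.2)) :
    (a - 1) * (d - 1) - b * c ≠ 0 := by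
  intro hdet
  apply hL
  -- A singular integer matrix has a nonzero integer kernel vector. Dividing it by its gcd gives a
  -- primitive `(p, q)`, which a unimodular matrix carries to `(1, 0)`.
  obtain ⟨v, hv, hv0⟩ := (Matrix.exists_mulVec_eq_zero_iff (M := !![a - 1, b; c, d - 1])).2
    (by rw [Matrix.det_fin_two_of, hdet])
  have e0 : (a - 1) * v 0 + b * v 1 = 0 := by
    simpa [Matrix.mulVec, dotProduct, Fin.sum_univ_two] using congrFun hv0 0
  have e1 : c * v 0 + (d - 1) * v 1 = 0 := by
    simpa [Matrix.mulVec, dotProduct, Fin.sum_univ_two] using congrFun hv0 1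
  have hg : 0 < Int.gcd (v 0) (v 1) := by
    rw [Nat.pos_iff_ne_zero, Ne, Int.gcd_eq_zero_iff]
    rintro ⟨h0, h1⟩
    exact hv (by ext i; fin_cases i <;> simpa)
  obtain ⟨p, q, hpq, hp, hq⟩ := Int.exists_gcd_one hg
  have hg' : ((Int.gcd (v 0) (v 1) : ℕ) : ℤ) ≠ 0 := by exact_mod_cast hg.ne'
  have f0 : (a - 1) * p + b * q = 0 := by
    refine mul_right_cancel₀ hg' ?_
    linear_combination e0 - (a - 1) * hp - b * hq
  have f1 : c * p + (d - 1) * q = 0 := by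
    refine mul_right_cancel₀ hg' ?_
    linear_combination e1 - c * hp - (d - 1) * hq
  obtain ⟨u, w, huw⟩ := Int.isCoprime_iff_gcd_eq_one.2 hpq
  have hP := isLift_unimodularHomeo u w p q huw
  rw [← lefschetzNumber_conj (unimodularHomeo UnitAddCircle u w p q huw) f]
  refine lefschetzNumber_eq_zero_of_commutes ((hP.mul h).mul hP.inv) fun x => ?_
  change unimodularHomeo ℝ u w p q huw (F ((unimodularHomeo ℝ u w p q huw).symm (x + intVec (1, 0))))
    = unimodularHomeo ℝ u w p q huw (F ((unimodularHomeo ℝ u w p q huw).symm x)) + intVec (1, 0)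
  have hinv : ∀ x : Plane, (unimodularHomeo ℝ u w p q huw).symm (x + intVec (1, 0)) =
      (unimodularHomeo ℝ u w p q huw).symm x + intVec (p, q) := fun x => by
    refine Prod.ext ?_ ?_
    · change p • (x.1 + ((1 : ℤ) : ℝ)) - w • (x.2 + ((0 : ℤ) : ℝ)) = p • x.1 - w • x.2 + (p : ℝ)
      simp only [zsmul_eq_mul]
      push_cast
      ring
    · change q • (x.1 + ((1 : ℤ) : ℝ)) + u • (x.2 + ((0 : ℤ) : ℝ)) = q • x.1 + u • x.2 + (q : ℝ)
      simp only [zsmul_eq_mul]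
      push_cast
      ring
  have hdir : ∀ x : Plane, unimodularHomeo ℝ u w p q huw (x + intVec (p, q)) =
      unimodularHomeo ℝ u w p q huw x + intVec (1, 0) := fun x => by
    have huw' : (u : ℝ) * p + w * q = 1 := by exact_mod_cast huw
    refine Prod.ext ?_ ?_
    · change u • (x.1 + (p : ℝ)) + w • (x.2 + (q : ℝ)) = u • x.1 + w • x.2 + ((1 : ℤ) : ℝ)
      simp only [zsmul_eq_mul]
      push_cast
      linear_combination huw'
    · change p • (x.2 + (q : ℝ)) - q • (x.1 + (p : ℝ)) = p • x.2 - q • x.1 + ((0 : ℤ) : ℝ)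
      simp only [zsmul_eq_mul]
      push_cast
      ring
  have hpq' : ((a * p + b * q, c * p + d * q) : ℤ × ℤ) = (p, q) :=
    Prod.ext (by linear_combination f0) (by linear_combination f1)
  rw [hinv, hA, hpq', hdir]

end LefschetzLift

end NilpotentTorus

namespace NilpotentTorus

open MeasureTheory

/-! ### Rotation vectors -/

section Rotation

/-- `F` commutes with the lattice translations. -/
def CommutesWithLattice (F : Plane ≃ₜ Plane) : Prop :=
  ∀ x v, F (x + intVec v) = F x + intVec v

theorem apply_fundamentalSection_proj {α : Type*} {g : Plane → α}
    (hg : ∀ x v, g (x + intVec v) = g x) (x : Plane) : g (fundamentalSection (proj x)) = g x := by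
  obtain ⟨v, hv⟩ := exists_intVec_of_proj_eq (proj_fundamentalSection (proj x)).symm
  rw [hv, hg]

theorem continuous_comp_fundamentalSection {g : Plane → Plane} (hgc : Continuous g)
    (hg : ∀ x v, g (x + intVec v) = g x) : Continuous fun z => g (fundamentalSection z) := by
  rw [isOpenQuotientMap_proj.isQuotientMap.continuous_iff]
  exact hgc.congr fun x => (apply_fundamentalSection_proj hg x).symm

theorem _root_.Continuous.integrable_torus {μ : Measure Torus} [IsProbabilityMeasure μ]
    {g : Torus → Plane} (hg : Continuous g) : Integrable g μ :=
  hg.integrable_of_hasCompactSupport (HasCompactSupport.of_compactSpace g)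

theorem integral_comp_of_map_eq {μ : Measure Torus} {φ : Torus ≃ₜ Torus} (h : μ.map φ = μ)
    (g : Torus → Plane) : ∫ z, g (φ z) ∂μ = ∫ z, g z ∂μ := by
  conv_rhs => rw [← h]
  exact (φ.measurableEmbedding.integral_map g).symm

variable {F F' : Plane ≃ₜ Plane} {φ φ' : Torus ≃ₜ Torus} {μ : Measure Torus}

theorem CommutesWithLattice.displacement_proj (hF : CommutesWithLattice F) (x : Plane) :
    displacement F (proj x) = F x - x :=
  apply_fundamentalSection_proj (g := fun x => F x - x)
    (fun x v => by rw [hF, add_sub_add_right_eq_sub]) x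

theorem CommutesWithLattice.continuous_displacement (hF : CommutesWithLattice F) :
    Continuous (displacement F) :=
  continuous_comp_fundamentalSection (g := fun x => F x - x) (by fun_prop)
    (fun x v => by rw [hF, add_sub_add_right_eq_sub])

theorem rotationVector_one : rotationVector μ 1 = 0 := by
  have h : ∀ z, displacement 1 z = 0 := fun z => sub_self _
  simp [rotationVector, h]

/-- The displacement of `F * F'` at `z` is that of `F` at `φ' z` plus that of `F'` at `z`;
invariance under `φ'` removes the shift. -/
theorem rotationVector_mul [IsProbabilityMeasure μ] (hF : CommutesWithLattice F)
    (hF' : CommutesWithLattice F') (h' : IsLift F' φ') (hμ : μ.map φ' = μ) :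
    rotationVector μ (F * F') = rotationVector μ F + rotationVector μ F' := by
  have h : ∀ z, displacement (F * F') z = displacement F (φ' z) + displacement F' z := by
    intro z
    obtain ⟨x, rfl⟩ := proj_surjective z
    have hFF : CommutesWithLattice (F * F') := fun x v => by
      change F (F' (x + _)) = F (F' x) + _
      rw [hF', hF]
    rw [← h', hFF.displacement_proj, hF.displacement_proj, hF'.displacement_proj,
      sub_add_sub_cancel]
    rfl
  have hi : Integrable (fun z => displacement F (φ' z)) μ :=
    (hF.continuous_displacement.comp φ'.continuous).integrable_torus
  rw [rotationVector, rotationVector, rotationVector, ← integral_comp_of_map_eq hμ (displacement F),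
    ← integral_add hi hF'.continuous_displacement.integrable_torus]
  simp_rw [h]

theorem rotationVector_inv [IsProbabilityMeasure μ] (hF : CommutesWithLattice F)
    (hF' : CommutesWithLattice F⁻¹) (h : IsLift F φ) (hμ : μ.map φ = μ) :
    rotationVector μ F⁻¹ = -rotationVector μ F := by
  have := rotationVector_mul hF' hF h hμ
  rw [inv_mul_cancel, rotationVector_one] at this
  exact eq_neg_of_add_eq_zero_left this.symm

/-- Two lifts differ by a lattice vector, and so do their rotation vectors, as `μ` has mass one. -/
theorem IsLift.eq_of_rotationVector_eq [IsProbabilityMeasure μ] (hF : CommutesWithLattice F)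
    (hF' : CommutesWithLattice F') (h : IsLift F φ) (h' : IsLift F' φ)
    (hr : rotationVector μ F = rotationVector μ F') : F = F' := by
  obtain ⟨v, hv⟩ := h.exists_add h'
  have hd : ∀ z, displacement F' z = displacement F z + intVec v := by
    intro z
    obtain ⟨x, rfl⟩ := proj_surjective z
    rw [hF'.displacement_proj, hF.displacement_proj, hv, add_sub_right_comm]
  have : rotationVector μ F' = rotationVector μ F + intVec v := by
    simp only [rotationVector, hd]
    rw [integral_add hF.continuous_displacement.integrable_torus (integrable_const _)]
    simp
  have hv0 : intVec v = 0 := by rwa [hr, left_eq_add] at this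
  ext1 x
  rw [hv, hv0, add_zero]

/-- The linear map of the plane with integer matrix `(a, b; c, d)`. -/
noncomputable def matrixMap (a b c d : ℤ) : Plane →L[ℝ] Plane :=
  ((a : ℝ) • ContinuousLinearMap.fst ℝ ℝ ℝ + (b : ℝ) • ContinuousLinearMap.snd ℝ ℝ ℝ).prod
    ((c : ℝ) • ContinuousLinearMap.fst ℝ ℝ ℝ + (d : ℝ) • ContinuousLinearMap.snd ℝ ℝ ℝ)

theorem matrixMap_apply (a b c d : ℤ) (x : Plane) :
    matrixMap a b c d x = (a * x.1 + b * x.2, c * x.1 + d * x.2) := rfl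

theorem matrixMap_intVec (a b c d : ℤ) (v : ℤ × ℤ) :
    matrixMap a b c d (intVec v) = intVec (a * v.1 + b * v.2, c * v.1 + d * v.2) := by
  simp [matrixMap_apply, intVec]

/-- `Ψ - A` is periodic and descends to a function `P`. At `ψ z` the conjugate has displacement `A
(displacement F z)` plus the coboundary `P (φ z) - P z`, whose integral vanishes by `φ`-invariance.
-/
theorem rotationVector_conj [IsProbabilityMeasure μ] {Ψ : Plane ≃ₜ Plane} {ψ : Torus ≃ₜ Torus}
    (hΨ : IsLift Ψ ψ) {a b c d : ℤ}
    (hA : ∀ x v, Ψ (x + intVec v) = Ψ x + matrixMap a b c d (intVec v))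
    (hF : CommutesWithLattice F) (hF' : CommutesWithLattice (Ψ * F * Ψ⁻¹)) (h : IsLift F φ)
    (hμ : μ.map φ = μ) (hμψ : μ.map ψ = μ) :
    rotationVector μ (Ψ * F * Ψ⁻¹) = matrixMap a b c d (rotationVector μ F) := by
  set A := matrixMap a b c d
  let p : Plane → Plane := fun x => Ψ x - A x
  have hp : ∀ x v, p (x + intVec v) = p x := fun x v => by
    simp only [p]
    rw [hA, map_add, add_sub_add_right_eq_sub]
  have hpc : Continuous p := by fun_prop
  let P : Torus → Plane := fun z => p (fundamentalSection z)
  have hPc : Continuous P := continuous_comp_fundamentalSection hpc hp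
  have hP : ∀ x, P (proj x) = p x := apply_fundamentalSection_proj hp
  have hd : ∀ z, displacement (Ψ * F * Ψ⁻¹) (ψ z) = A (displacement F z) + (P (φ z) - P z) := by
    intro z
    obtain ⟨x, rfl⟩ := proj_surjective z
    rw [← hΨ, ← h, hF'.displacement_proj, hF.displacement_proj, hP, hP]
    change Ψ (F (Ψ.symm (Ψ x))) - Ψ x = A (F x - x) + ((Ψ (F x) - A (F x)) - (Ψ x - A x))
    rw [Ψ.symm_apply_apply, map_sub]
    abel
  have hi : Integrable (fun z => P (φ z)) μ := (hPc.comp φ.continuous).integrable_torus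
  have hi' : Integrable (fun z => P (φ z) - P z) μ := hi.sub hPc.integrable_torus
  have hAi : Integrable (fun z => A (displacement F z)) μ :=
    (A.continuous.comp hF.continuous_displacement).integrable_torus
  rw [rotationVector, ← integral_comp_of_map_eq hμψ]
  simp_rw [hd]
  rw [integral_add hAi hi', integral_sub hi hPc.integrable_torus,
    integral_comp_of_map_eq hμ P, sub_self, add_zero,
    A.integral_comp_comm hF.continuous_displacement.integrable_torus]
  rfl

end Rotation

/-! ### Invariant group lifts and nilpotency -/

section Nilpotent

/-- Lifts of elements of homeomorphisms isotopic to the identity commute with the lattice. -/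
theorem IsLift.commutesWithLattice {F : Plane ≃ₜ Plane} {φ : Torus ≃ₜ Torus} (h : IsLift F φ)
    (hφ : IsotopicToId φ) : CommutesWithLattice F := h.map_add_intVec hφ

theorem IsGroupLift.exists_mem {K : Subgroup (Plane ≃ₜ Plane)} {H : Subgroup (Torus ≃ₜ Torus)}
    (hK : IsGroupLift K H) {φ : Torus ≃ₜ Torus} (hφ : φ ∈ H) : ∃ F ∈ K, IsLift F φ := by
  obtain ⟨κ, hκ⟩ := hK
  obtain ⟨F, hF⟩ := κ.surjective ⟨φ, hφ⟩
  have := hκ F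
  rw [hF] at this
  exact ⟨F, F.2, this⟩

theorem IsGroupLift.exists_isLift {K : Subgroup (Plane ≃ₜ Plane)} {H : Subgroup (Torus ≃ₜ Torus)}
    (hK : IsGroupLift K H) {F : Plane ≃ₜ Plane} (hF : F ∈ K) : ∃ φ ∈ H, IsLift F φ := by
  obtain ⟨κ, hκ⟩ := hK
  exact ⟨κ ⟨F, hF⟩, (κ ⟨F, hF⟩).2, hκ ⟨F, hF⟩⟩

theorem IsGroupLift.mem_of_isLift {K : Subgroup (Plane ≃ₜ Plane)} {H : Subgroup (Torus ≃ₜ Torus)}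
    (hK : IsGroupLift K H) {F : Plane ≃ₜ Plane} (hF : F ∈ K) {φ : Torus ≃ₜ Torus}
    (h : IsLift F φ) : φ ∈ H := by
  obtain ⟨φ', hφ', h'⟩ := hK.exists_isLift hF
  rwa [h.unique h']

theorem IsGroupLift.eq_one {K : Subgroup (Plane ≃ₜ Plane)} {H : Subgroup (Torus ≃ₜ Torus)}
    (hK : IsGroupLift K H) {F : Plane ≃ₜ Plane} (hF : F ∈ K) (h : IsLift F 1) : F = 1 := by
  obtain ⟨κ, hκ⟩ := hK
  have h1 : κ ⟨F, hF⟩ = 1 := Subtype.ext ((hκ ⟨F, hF⟩).unique h)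
  exact congrArg Subtype.val ((map_eq_one_iff κ κ.injective).1 h1)

theorem NormalizedBy.conj_mem {K : Subgroup (Plane ≃ₜ Plane)} {Ψ F : Plane ≃ₜ Plane}
    (h : NormalizedBy K Ψ) (hF : F ∈ K) : Ψ * F * Ψ⁻¹ ∈ K := by
  have : Ψ * F * Ψ⁻¹ ∈ (K : Set (Plane ≃ₜ Plane)) := h ▸ ⟨F, hF, rfl⟩
  exact this

/-- Iterated commutators with `Ψ` multiply the rotation vector by powers of the injective map `B = A
- I`, yet become trivial by nilpotency. -/
theorem rotationVector_eq_zero_of_normalizedBy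
    {G : Subgroup (Torus ≃ₜ Torus)} (hG : Group.IsNilpotent G)
    {ψ : Torus ≃ₜ Torus} (hψ : ψ ∈ G) (hL : lefschetzNumber (ψ : C(Torus, Torus)) ≠ 0)
    {Ψ : Plane ≃ₜ Plane} (hΨ : IsLift Ψ ψ) {μ : Measure Torus} (hμ : μ ∈ invariantMeasures G)
    {H : Subgroup (Torus ≃ₜ Torus)} (hH : (H : Set (Torus ≃ₜ Torus)) ⊆ isotopicPart G)
    {K : Subgroup (Plane ≃ₜ Plane)} (hK : IsGroupLift K H) (hKΨ : NormalizedBy K Ψ)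
    {F : Plane ≃ₜ Plane} (hF : F ∈ K) : rotationVector μ F = 0 := by
  have := hμ.1
  obtain ⟨a, b, c, d, hA⟩ := hΨ.exists_matrix
  have hdet := det_ne_zero_of_lefschetzNumber_ne_zero hΨ hL hA
  simp_rw [← matrixMap_intVec] at hA
  have hcomm : ∀ C ∈ K, CommutesWithLattice C := fun C hC => by
    obtain ⟨φ, hφ, h⟩ := hK.exists_isLift hC
    exact h.commutesWithLattice (hH hφ).2
  let B : Plane →ₗ[ℝ] Plane := (matrixMap a b c d : Plane →ₗ[ℝ] Plane) - LinearMap.id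
  have hB : Function.Injective B := by
    rw [injective_iff_map_eq_zero]
    intro x hx
    have hx1 : (a * x.1 + b * x.2) - x.1 = 0 := congrArg Prod.fst hx
    have hx2 : (c * x.1 + d * x.2) - x.2 = 0 := congrArg Prod.snd hx
    have hdet' : ((a : ℝ) - 1) * (d - 1) - b * c ≠ 0 := by exact_mod_cast hdet
    refine Prod.ext (mul_left_cancel₀ hdet' ?_) (mul_left_cancel₀ hdet' ?_)
    · change _ * x.1 = _ * (0 : ℝ)
      linear_combination ((d : ℝ) - 1) * hx1 - b * hx2
    · change _ * x.2 = _ * (0 : ℝ)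
      linear_combination ((a : ℝ) - 1) * hx2 - c * hx1
  have hseq : ∀ k : ℕ, ∃ C ∈ K, ∃ g ∈ G.lowerCentralSeries k, IsLift C g ∧
      rotationVector μ C = B^[k] (rotationVector μ F) := by
    intro k
    induction k with
    | zero =>
      obtain ⟨φ, hφ, h⟩ := hK.exists_isLift hF
      exact ⟨F, hF, φ, (hH hφ).1, h, rfl⟩
    | succ k ih =>
      obtain ⟨C, hC, g, hgk, hg, hr⟩ := ih
      have hgG : g ∈ G := (hH (hK.mem_of_isLift hC hg)).1
      have hC' := hKΨ.conj_mem hC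
      have hCi := K.inv_mem hC
      have hgμ := hμ.2 g hgG
      refine ⟨Ψ * C * Ψ⁻¹ * C⁻¹, K.mul_mem hC' hCi, ψ * g * ψ⁻¹ * g⁻¹, ?_,
        ((hΨ.mul hg).mul hΨ.inv).mul hg.inv, ?_⟩
      · have h1 := Subgroup.commutator_mem_commutator hψ hgk
        rw [Subgroup.commutator_comm] at h1
        exact h1
      · rw [rotationVector_mul (hcomm _ hC') (hcomm _ hCi) hg.inv (hμ.2 _ (G.inv_mem hgG)),
          rotationVector_conj hΨ hA (hcomm C hC) (hcomm _ hC') hg hgμ (hμ.2 ψ hψ),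
          rotationVector_inv (hcomm C hC) (hcomm _ hCi) hg hgμ,
          Function.iterate_succ_apply', ← hr, ← sub_eq_add_neg]
        rfl
  obtain ⟨N, hN⟩ := (Subgroup.isNilpotent_iff_lowerCentralSeries G).1 hG
  obtain ⟨C, hC, g, hgN, hg, hr⟩ := hseq N
  rw [hN, Subgroup.mem_bot] at hgN
  subst hgN
  -- A priori `C`, a lift of the identity, is only a lattice translation; injectivity of the
  -- projection from `K` makes it trivial.
  rw [hK.eq_one hC hg, rotationVector_one] at hr
  have h0 : B^[N] 0 = 0 := by
    rw [← Module.End.pow_apply, map_zero]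
  exact hB.iterate N (hr.symm.trans h0.symm)

/-- The lifts of elements of `H` with zero rotation vector. -/
def zeroRotationLifts (H : Subgroup (Torus ≃ₜ Torus)) (μ : Measure Torus) [IsProbabilityMeasure μ]
    (hμ : ∀ φ ∈ H, μ.map φ = μ) (hH : ∀ φ ∈ H, IsotopicToId φ) : Subgroup (Plane ≃ₜ Plane) where
  carrier := {F | (∃ φ ∈ H, IsLift F φ) ∧ rotationVector μ F = 0}
  one_mem' := ⟨⟨1, H.one_mem, IsLift.one⟩, rotationVector_one⟩
  mul_mem' := by
    rintro F F' ⟨⟨φ, hφ, h⟩, hr⟩ ⟨⟨φ', hφ', h'⟩, hr'⟩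
    refine ⟨⟨φ * φ', H.mul_mem hφ hφ', h.mul h'⟩, ?_⟩
    rw [rotationVector_mul (h.commutesWithLattice (hH φ hφ))
      (h'.commutesWithLattice (hH φ' hφ')) h' (hμ φ' hφ'), hr, hr', add_zero]
  inv_mem' := by
    rintro F ⟨⟨φ, hφ, h⟩, hr⟩
    refine ⟨⟨φ⁻¹, H.inv_mem hφ, h.inv⟩, ?_⟩
    rw [rotationVector_inv (h.commutesWithLattice (hH φ hφ))
      (h.inv.commutesWithLattice (hH φ⁻¹ (H.inv_mem hφ))) h (hμ φ hφ), hr, neg_zero]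

/-- `hex` makes the projection surjective; `IsLift.eq_of_rotationVector_eq` makes it injective. -/
theorem isGroupLift_zeroRotationLifts {H : Subgroup (Torus ≃ₜ Torus)} {μ : Measure Torus}
    [IsProbabilityMeasure μ] (hμ : ∀ φ ∈ H, μ.map φ = μ) (hH : ∀ φ ∈ H, IsotopicToId φ)
    (hex : ∀ φ ∈ H, ∃ F : Plane ≃ₜ Plane, IsLift F φ ∧ rotationVector μ F = 0) :
    IsGroupLift (zeroRotationLifts H μ hμ hH) H := by
  choose κ hκH hκ using fun F : zeroRotationLifts H μ hμ hH => F.2.1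
  let f : zeroRotationLifts H μ hμ hH →* H :=
    { toFun := fun F => ⟨κ F, hκH F⟩
      map_one' := Subtype.ext ((hκ 1).unique IsLift.one)
      map_mul' := fun F F' => Subtype.ext ((hκ (F * F')).unique ((hκ F).mul (hκ F'))) }
  refine ⟨MulEquiv.ofBijective f ⟨fun F F' h => ?_, fun φ => ?_⟩, hκ⟩
  · have h' : κ F = κ F' := congrArg Subtype.val h
    have hF' := hκ F'
    rw [← h'] at hF'
    have hi := hH _ (hκH F)
    exact Subtype.ext ((hκ F).eq_of_rotationVector_eq ((hκ F).commutesWithLattice hi)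
      (hF'.commutesWithLattice hi) hF' (F.2.2.trans F'.2.2.symm))
  · obtain ⟨F, hF, hr⟩ := hex φ φ.2
    exact ⟨⟨F, ⟨φ, φ.2, hF⟩, hr⟩, Subtype.ext ((hκ _).unique hF)⟩

theorem conj_mem_zeroRotationLifts {H : Subgroup (Torus ≃ₜ Torus)} {μ : Measure Torus}
    [IsProbabilityMeasure μ] (hμ : ∀ φ ∈ H, μ.map φ = μ) (hH : ∀ φ ∈ H, IsotopicToId φ)
    {Ψ : Plane ≃ₜ Plane} {ψ : Torus ≃ₜ Torus} (hΨ : IsLift Ψ ψ) (hψ : μ.map ψ = μ)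
    (hconj : ∀ φ ∈ H, ψ * φ * ψ⁻¹ ∈ H) {F : Plane ≃ₜ Plane}
    (hF : F ∈ zeroRotationLifts H μ hμ hH) : Ψ * F * Ψ⁻¹ ∈ zeroRotationLifts H μ hμ hH := by
  obtain ⟨⟨φ, hφ, h⟩, hr⟩ := hF
  have hlift := (hΨ.mul h).mul hΨ.inv
  refine ⟨⟨_, hconj φ hφ, hlift⟩, ?_⟩
  obtain ⟨a, b, c, d, hA⟩ := hΨ.exists_matrix
  simp_rw [← matrixMap_intVec] at hA
  rw [rotationVector_conj hΨ hA (h.commutesWithLattice (hH φ hφ))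
    (hlift.commutesWithLattice (hH _ (hconj φ hφ))) h (hμ φ hφ) hψ, hr, map_zero]

end Nilpotent

end NilpotentTorus

/-! ### The proposition -/

open NilpotentTorus
theorem mainTheorem7
    (G : Subgroup (Torus ≃ₜ Torus)) (hG : Group.IsNilpotent G)
    (ψ : Torus ≃ₜ Torus) (hψ : ψ ∈ G)
    (hL : lefschetzNumber (ψ : C(Torus, Torus)) ≠ 0)
    (Ψ : Plane ≃ₜ Plane) (hΨ : IsLift Ψ ψ)
    (μ : MeasureTheory.Measure Torus) (hμ : μ ∈ invariantMeasures G)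
    (H : Subgroup (Torus ≃ₜ Torus)) (hHG : H ≤ G) (hHn : (H.subgroupOf G).Normal)
    (hH : (H : Set (Torus ≃ₜ Torus)) ⊆ isotopicPart G) :
    ((∃ K : Subgroup (Plane ≃ₜ Plane), IsGroupLift K H ∧ NormalizedBy K Ψ) ↔
      (H : Set (Torus ≃ₜ Torus)) ⊆ irrotational G μ) ∧
    ∀ K : Subgroup (Plane ≃ₜ Plane), IsGroupLift K H → NormalizedBy K Ψ →
      (K : Set (Plane ≃ₜ Plane)) ⊆ irrotationalLifts G μ := by
  have hprob := hμ.1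
  refine ⟨⟨?_, fun hirr => ?_⟩, fun K hK hKΨ F hF => ?_⟩
  · rintro ⟨K, hK, hKΨ⟩ φ hφ
    obtain ⟨F, hF, h⟩ := hK.exists_mem hφ
    exact ⟨hH hφ, F, h, rotationVector_eq_zero_of_normalizedBy hG hψ hL hΨ hμ hH hK hKΨ hF⟩
  · have hμH : ∀ φ ∈ H, μ.map φ = μ := fun φ hφ => hμ.2 φ (hHG hφ)
    have hiso : ∀ φ ∈ H, IsotopicToId φ := fun φ hφ => (hH hφ).2
    have hconj : ∀ g ∈ G, ∀ φ ∈ H, g * φ * g⁻¹ ∈ H := fun g hg φ hφ =>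
      hHn.conj_mem ⟨φ, hHG hφ⟩ hφ ⟨g, hg⟩
    refine ⟨zeroRotationLifts H μ hμH hiso,
      isGroupLift_zeroRotationLifts hμH hiso fun φ hφ => (hirr hφ).2, ?_⟩
    refine Set.Subset.antisymm ?_ fun F hF => ?_
    · rintro _ ⟨F, hF, rfl⟩
      exact conj_mem_zeroRotationLifts hμH hiso hΨ (hμ.2 ψ hψ) (hconj ψ hψ) hF
    -- The reverse inclusion is invariance under conjugation by `Ψ⁻¹`, a lift of `ψ⁻¹ ∈ G`.
    · exact ⟨Ψ⁻¹ * F * Ψ⁻¹⁻¹, conj_mem_zeroRotationLifts hμH hiso hΨ.inv (hμ.2 _ (G.inv_mem hψ))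
        (hconj ψ⁻¹ (G.inv_mem hψ)) hF, by simp only; group⟩
  · obtain ⟨φ, hφ, h⟩ := hK.exists_isLift hF
    exact ⟨h.isotopicToId (hH hφ).2, ⟨φ, hH hφ, h⟩,
      rotationVector_eq_zero_of_normalizedBy hG hψ hL hΨ hμ hH hK hKΨ hF⟩
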